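/- Let \(N\ge 1\) be an integer and \(0<\alpha<N\). For \(x\in\mathbb R^N\setminus\{0\}\) let \[ I_\alpha(x)=\frac{\Gamma\bigl(\tfrac{N-\alpha}{2}\bigr)}{2^{\alpha}\pi^{N/2}\,\Gamma\bigl(\tfrac{\alpha}{2}\bigr)\,|x|^{N-\alpha}} \] be the Riesz potential of order \(\alpha\). All functions are real-valued. For \(u\in L^2(\mathbb R^N)\) put \[ D(u)=\int_{\mathbb R^N}\bigl(I_\alpha * |u|^{\frac{\alpha}{N}+1}\bigr)\,|u|^{\frac{\alpha}{N}+1}. \] For \(V\in L^\infty(\mathbb R^N)\) define \[ c_*=\inf\Bigl\{\int_{\mathbb R^N}|\nabla u|^2+V|u|^2 \;:\; u\in H^1(\mathbb R^N),\ D(u)=1\Bigr\}, \qquad c_\infty=\inf\Bigl\{\int_{\mathbb R^N}|u|^2 \;:\; u\in L^2(\mathbb R^N),\ D(u)=1\Bigr\}. \] **Theorem (Existence of a minimizer).** Let \(V\in L^\infty(\mathbb R^N)\) satisfy \(\liminf_{|x|\to\infty}V(x)\ge 1\), the limit inferior being understood up to null sets: for every \(\varepsilon>0\) there is \(R>0\)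 such that \(V(x)\ge 1-\varepsilon\) for almost every \(x\) with \(|x|\ge R\). If \(c_*<c_\infty\), then the infimum \(c_*\) is achieved, that is, there is \(u\in H^1(\mathbb R^N)\) with \(D(u)=1\) and \(\int_{\mathbb R^N}|\nabla u|^2+V|u|^2=c_*\). Moreover, every minimizing sequence for \(c_*\), that is, every sequence \((u_n)_{n\in\mathbb N}\) in \(H^1(\mathbb R^N)\) with \(D(u_n)=1\) for all \(n\) and \(\int_{\mathbb R^N}|\nabla u_n|^2+V|u_n|^2\to c_*\), has a subsequence that converges strongly in \(H^1(\mathbb R^N)\). -/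

import Mathlib

open MeasureTheory Filter Topology
open scoped ENNReal ContDiff

noncomputable section

namespace Choquard

/-- The Euclidean space `ℝ^N`. -/
abbrev Space (N : ℕ) : Type := EuclideanSpace ℝ (Fin N)

/-- The space `L²(ℝ^N)` of real-valued functions. -/
abbrev L2 (N : ℕ) : Type := Lp ℝ 2 (volume : Measure (Space N))

/-- The space `L²(ℝ^N; ℝ^N)` of vector fields. -/
abbrev L2Field (N : ℕ) : Type := Lp (Space N) 2 (volume : Measure (Space N))

/-- The vector field `g` is the weak gradient of `u`:
`∫ u ∂_v φ = - ∫ ⟨g, v⟩ φ` for every test function `φ ∈ C_c^∞(ℝ^N)` and every direction `v`. -/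
def IsWeakGradient {N : ℕ} (u : L2 N) (g : L2Field N) : Prop :=
  ∀ φ : Space N → ℝ, ContDiff ℝ ∞ φ → HasCompactSupport φ → ∀ v : Space N,
    ∫ x, u x * fderiv ℝ φ x v = - ∫ x, inner ℝ (g x) v * φ x

theorem integrable_mul_fderiv {N : ℕ} (u : L2 N) {φ : Space N → ℝ} (hφ : ContDiff ℝ ∞ φ)
    (hc : HasCompactSupport φ) (v : Space N) :
    Integrable (fun x => u x * fderiv ℝ φ x v) := by
  have h1 : Continuous (fun x => fderiv ℝ φ x v) :=
    (hφ.continuous_fderiv (by simp)).clm_apply continuous_const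
  have h2 : HasCompactSupport (fun x => fderiv ℝ φ x v) := hc.fderiv_apply ℝ v
  exact (Lp.memLp u).integrable_mul (q := 2) (h1.memLp_of_hasCompactSupport h2)

theorem integrable_inner_mul {N : ℕ} (g : L2Field N) {φ : Space N → ℝ} (hφ : ContDiff ℝ ∞ φ)
    (hc : HasCompactSupport φ) (v : Space N) :
    Integrable (fun x => inner ℝ (g x) v * φ x) :=
  ((Lp.memLp g).inner_const v).integrable_mul (q := 2)
    (hφ.continuous.memLp_of_hasCompactSupport hc)

/-- The Sobolev space `H¹(ℝ^N)`: a function `u ∈ L²(ℝ^N)` having a weak gradient in `L²`, stored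
as the pair `(u, ∇u)` (the weak gradient is unique as an element of `L²`). The norm inherited from
the `ℓ²`-product is the usual one, `‖u‖²_{H¹} = ∫ |u|² + ∫ |∇u|²`. -/
def H1 (N : ℕ) : Submodule ℝ (WithLp 2 (L2 N × L2Field N)) where
  carrier := {w | IsWeakGradient w.fst w.snd}
  zero_mem' := by
    intro φ _ _ v
    have h1 : ∫ x, (0 : L2 N) x * fderiv ℝ φ x v = 0 := by
      refine integral_eq_zero_of_ae ?_
      filter_upwards [Lp.coeFn_zero ℝ 2 (volume : Measure (Space N))] with x hx
      rw [hx]; simp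
    have h2 : ∫ x, inner ℝ ((0 : L2Field N) x) v * φ x = 0 := by
      refine integral_eq_zero_of_ae ?_
      filter_upwards [Lp.coeFn_zero (Space N) 2 (volume : Measure (Space N))] with x hx
      rw [hx]; simp
    exact h1.trans (by change (0 : ℝ) = - ∫ x, inner ℝ ((0 : L2Field N) x) v * φ x; rw [h2, neg_zero])
  add_mem' := by
    intro a b ha hb φ hφ hc v
    have h1 : ∫ x, (a.fst + b.fst : L2 N) x * fderiv ℝ φ x v
        = ∫ x, (a.fst x * fderiv ℝ φ x v + b.fst x * fderiv ℝ φ x v) := by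
      refine integral_congr_ae ?_
      filter_upwards [Lp.coeFn_add a.fst b.fst] with x hx
      rw [hx, Pi.add_apply, add_mul]
    have h2 : ∫ x, inner ℝ ((a.snd + b.snd : L2Field N) x) v * φ x
        = ∫ x, (inner ℝ (a.snd x) v * φ x + inner ℝ (b.snd x) v * φ x) := by
      refine integral_congr_ae ?_
      filter_upwards [Lp.coeFn_add a.snd b.snd] with x hx
      rw [hx, Pi.add_apply, inner_add_left, add_mul]
    rw [integral_add (integrable_mul_fderiv _ hφ hc v) (integrable_mul_fderiv _ hφ hc v)] at h1
    rw [integral_add (integrable_inner_mul _ hφ hc v) (integrable_inner_mul _ hφ hc v)] at h2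
    have e1 := ha φ hφ hc v
    have e2 := hb φ hφ hc v
    change ∫ x, (a.fst + b.fst : L2 N) x * fderiv ℝ φ x v
      = - ∫ x, inner ℝ ((a.snd + b.snd : L2Field N) x) v * φ x
    rw [h1, h2, e1, e2]
    ring
  smul_mem' := by
    intro c a ha φ hφ hc v
    have h1 : ∫ x, (c • a.fst : L2 N) x * fderiv ℝ φ x v
        = ∫ x, c * (a.fst x * fderiv ℝ φ x v) := by
      refine integral_congr_ae ?_
      filter_upwards [Lp.coeFn_smul c a.fst] with x hx
      rw [hx, Pi.smul_apply, smul_eq_mul, mul_assoc]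
    have h2 : ∫ x, inner ℝ ((c • a.snd : L2Field N) x) v * φ x
        = ∫ x, c * (inner ℝ (a.snd x) v * φ x) := by
      refine integral_congr_ae ?_
      filter_upwards [Lp.coeFn_smul c a.snd] with x hx
      rw [hx, Pi.smul_apply, real_inner_smul_left, mul_assoc]
    have e1 := ha φ hφ hc v
    change ∫ x, (c • a.fst : L2 N) x * fderiv ℝ φ x v
      = - ∫ x, inner ℝ ((c • a.snd : L2Field N) x) v * φ x
    rw [h1, h2, integral_const_mul, integral_const_mul, e1]
    ring

/-- The function underlying an element of `H¹(ℝ^N)`. -/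
def toL2 {N : ℕ} (u : H1 N) : L2 N := u.1.fst

/-- The weak gradient of an element of `H¹(ℝ^N)`. -/
def weakGrad {N : ℕ} (u : H1 N) : L2Field N := u.1.snd

/-- The Riesz potential `I_α` of order `α` (its value at the origin is irrelevant). -/
def rieszKernel (N : ℕ) (α : ℝ) (x : Space N) : ℝ :=
  Real.Gamma ((N - α) / 2) /
    (2 ^ α * Real.pi ^ ((N : ℝ) / 2) * Real.Gamma (α / 2) * ‖x‖ ^ ((N : ℝ) - α))

/-- The convolution `I_α ∗ |u|^{α/N + 1}`, with values in `[0, ∞]`. -/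
def rieszPotential {N : ℕ} (α : ℝ) (u : L2 N) (x : Space N) : ℝ≥0∞ :=
  ∫⁻ y, ENNReal.ofReal (rieszKernel N α (x - y)) * ENNReal.ofReal (|u y| ^ (α / N + 1))

/-- The nonlocal functional `∫ (I_α ∗ |u|^{α/N + 1}) |u|^{α/N + 1}`, with values in `[0, ∞]`. -/
def nonlocalEnergy {N : ℕ} (α : ℝ) (u : L2 N) : ℝ≥0∞ :=
  ∫⁻ x, rieszPotential α u x * ENNReal.ofReal (|u x| ^ (α / N + 1))

/-- The quadratic functional `∫ |∇u|² + V |u|²` on `H¹(ℝ^N)`. -/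
def energy {N : ℕ} (V : Space N → ℝ) (u : H1 N) : ℝ :=
  ∫ x, (‖weakGrad u x‖ ^ 2 + V x * |toL2 u x| ^ 2)

/-- The level `c_∞`, as an infimum in the extended reals. -/
def cInfty (N : ℕ) (α : ℝ) : EReal :=
  sInf {c : EReal | ∃ u : L2 N, nonlocalEnergy α u = 1 ∧ c = ((∫ x, |u x| ^ 2 : ℝ) : EReal)}

/-- The level `c_*`, as an infimum in the extended reals. -/
def cStar {N : ℕ} (α : ℝ) (V : Space N → ℝ) : EReal :=
  sInf {c : EReal | ∃ u : H1 N, nonlocalEnergy α (toL2 u) = 1 ∧ c = (energy V u : EReal)}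

/-- `u` is a minimizer for `c_*`. -/
def IsMinimizer {N : ℕ} (α : ℝ) (V : Space N → ℝ) (u : H1 N) : Prop :=
  nonlocalEnergy α (toL2 u) = 1 ∧ (energy V u : EReal) = cStar α V

/-- `u₀, u₁, …` is a minimizing sequence for `c_*`. -/
def IsMinimizingSeq {N : ℕ} (α : ℝ) (V : Space N → ℝ) (u : ℕ → H1 N) : Prop :=
  (∀ n, nonlocalEnergy α (toL2 (u n)) = 1) ∧
    Tendsto (fun n => (energy V (u n) : EReal)) atTop (𝓝 (cStar α V))

/-- The limit inferior of `V(x)` as `|x| → ∞`, null sets being disregarded because `V` is only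
given almost everywhere. -/
def liminfAtInfinity {N : ℕ} (V : Space N → ℝ) : EReal :=
  liminf (fun x => (V x : EReal)) (cocompact (Space N) ⊓ ae volume)

end Choquard

end

/-! Concentration-compactness reduced to one strict subadditivity inequality. Put `p = α/N + 1`, so
`1 < p < 2`. Let `v` be the weak limit of a bounded minimizing sequence `u n`, let `w n = u n - v`
and `d = D(v)`. The energy is quadratic with weakly continuous polarization, so it splits as `E(u n)
= E(v) + E(w n) + o(1)`. The nonlocal term splits at least from one side: `1 ≤ D(v) + liminf D(w
n)`. By Rellich, `w n` tends to `0` in `L²` on every ball, so only the behaviour of `V` at infinity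
matters and `E(w n) ≥ a ‖w n‖² - o(1)` for each `a < 1`. Homogeneity then gives `c_* ≥ c_* d^(1/p) +
c_∞ (1-d)^(1/p)`. Since `d^(1/p) + (1-d)^(1/p) ≥ 1`, `c_∞ ≥ 0` and `c_* < c_∞`, this forces `d = 1`.
Hence `v` is a minimizer, `E(w n) → 0`, and coercivity up to local mass makes `w n → 0` in `H¹`.

The one-sided Brezis–Lieb inequality rests on writing the Riesz kernel as a superposition of
products of Gaussians. This turns `D(u)` into `∫ (∫ h_τ |u|^p)² dν(τ)`, a squared `L²(ν)` norm. The
cross term is then a pairing of a fixed `L²(ν)` function with a bounded sequence tending to `0`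
almost everywhere.

The Hardy–Littlewood–Sobolev inequality is not needed: `D` takes values in `[0, ∞]`, and the
remainders have finite `D` because `D(u - v)` is bounded by a multiple of `D(u) + D(v)`. The main
carriers are `one_le_add_of_frequently_le`, `nonlocalEnergy_eq`, `tendsto_lintegral_enorm_sq_mul`
and `exists_subseq_tendsto_minimizer`. -/

open MeasureTheory Filter Topology
open scoped ENNReal ContDiff

/-! ### Convergence of integrals and elementary inequalities in `[0, ∞]`. -/

namespace Choquard

section Measure

variable {X : Type*} [MeasurableSpace X] {μ : Measure X}

/-- A variant of dominated convergence with a small, merely bounded, error term. -/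
theorem tendsto_lintegral_zero_of_le_add {H K : ℕ → X → ℝ≥0∞} {C : ℝ≥0∞} (hC : C ≠ ⊤)
    (hH : ∀ n, AEMeasurable (H n) μ) (hK : ∀ n, AEMeasurable (K n) μ)
    (h0 : ∀ᵐ x ∂μ, Tendsto (fun n => H n x) atTop (𝓝 0)) (hKC : ∀ n, ∫⁻ x, K n x ∂μ ≤ C)
    (hdom : ∀ ε : NNReal, 0 < ε → ∃ Φ : X → ℝ≥0∞, AEMeasurable Φ μ ∧ ∫⁻ x, Φ x ∂μ ≠ ⊤ ∧
      ∀ n x, H n x ≤ Φ x + ε * K n x) :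
    Tendsto (fun n => ∫⁻ x, H n x ∂μ) atTop (𝓝 0) := by
  rw [ENNReal.tendsto_nhds_zero]
  intro η hη
  obtain ⟨ε, hε, hεC⟩ := ENNReal.exists_nnreal_pos_mul_lt hC (ENNReal.half_pos hη.ne').ne'
  obtain ⟨Φ, hΦm, hΦ, hle⟩ := hdom ε hε
  -- `H n ≤ min (H n) Φ + ε K n`: the minimum is dominated by `Φ`, and the rest costs at most `ε C`.
  have hlim : Tendsto (fun n => ∫⁻ x, min (H n x) (Φ x) ∂μ) atTop (𝓝 (∫⁻ _, 0 ∂μ)) := by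
    refine tendsto_lintegral_of_dominated_convergence' Φ (fun n => (hH n).min hΦm)
      (fun n => .of_forall fun x => min_le_right _ _) hΦ ?_
    filter_upwards [h0] with x hx
    exact tendsto_of_tendsto_of_tendsto_of_le_of_le tendsto_const_nhds hx
      (fun _ => zero_le) (fun _ => min_le_left _ _)
  rw [lintegral_zero, ENNReal.tendsto_nhds_zero] at hlim
  filter_upwards [hlim (η / 2) (ENNReal.half_pos hη.ne')] with n hn
  calc ∫⁻ x, H n x ∂μ ≤ ∫⁻ x, (min (H n x) (Φ x) + ε * K n x) ∂μ := by
        refine lintegral_mono fun x => ?_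
        rcases le_total (H n x) (Φ x) with h | h
        · rw [min_eq_left h]; exact le_self_add
        · rw [min_eq_right h]; exact hle n x
    _ = ∫⁻ x, min (H n x) (Φ x) ∂μ + ε * ∫⁻ x, K n x ∂μ := by
        rw [lintegral_add_left' ((hH n).min hΦm), lintegral_const_mul'' _ (hK n)]
    _ ≤ η / 2 + η / 2 := by
        gcongr
        exact (mul_le_mul_right (hKC n) _).trans hεC.le
    _ = η := ENNReal.add_halves η

theorem mul_le_sq_div_add (a b : ℝ≥0∞) {ε : NNReal} (hε : 0 < ε) :
    a * b ≤ a ^ 2 * (ε : ℝ≥0∞)⁻¹ + ε * b ^ 2 := by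
  have hε0 : (ε : ℝ≥0∞) ≠ 0 := by simpa using hε.ne'
  rcases le_total a (ε * b) with h | h
  · calc a * b ≤ ε * b * b := by gcongr
      _ = ε * b ^ 2 := by ring
      _ ≤ _ := le_add_self
  · have : b ≤ (ε : ℝ≥0∞)⁻¹ * a := by
      rw [← ENNReal.mul_le_iff_le_inv hε0 ENNReal.coe_ne_top]; exact h
    calc a * b ≤ a * ((ε : ℝ≥0∞)⁻¹ * a) := by gcongr
      _ = a ^ 2 * (ε : ℝ≥0∞)⁻¹ := by ring
      _ ≤ _ := le_self_add

/-- A sequence bounded in `L²` converging to zero almost everywhere converges weakly to zero. -/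
theorem tendsto_lintegral_mul_zero {F : X → ℝ≥0∞} {G : ℕ → X → ℝ≥0∞} {C : ℝ≥0∞} (hC : C ≠ ⊤)
    (hF : AEMeasurable F μ) (hG : ∀ n, AEMeasurable (G n) μ) (hF2 : ∫⁻ x, F x ^ 2 ∂μ ≠ ⊤)
    (hGC : ∀ n, ∫⁻ x, G n x ^ 2 ∂μ ≤ C)
    (h0 : ∀ᵐ x ∂μ, Tendsto (fun n => G n x) atTop (𝓝 0)) :
    Tendsto (fun n => ∫⁻ x, F x * G n x ∂μ) atTop (𝓝 0) := by
  refine tendsto_lintegral_zero_of_le_add (K := fun n x => G n x ^ 2) hC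
    (fun n => hF.mul (hG n)) (fun n => (hG n).pow_const 2) ?_ hGC ?_
  · have hfin : ∀ᵐ x ∂μ, F x ^ 2 < ⊤ := ae_lt_top' (hF.pow_const 2) hF2
    filter_upwards [h0, hfin] with x hx hFx
    have hFx' : F x ≠ ⊤ := by
      rintro h; simp [h] at hFx
    simpa using ENNReal.Tendsto.const_mul hx (Or.inr hFx')
  · intro ε hε
    refine ⟨fun x => F x ^ 2 * (ε : ℝ≥0∞)⁻¹, (hF.pow_const 2).mul_const _, ?_,
      fun n x => mul_le_sq_div_add _ _ hε⟩
    rw [lintegral_mul_const'' _ (hF.pow_const 2)]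
    exact ENNReal.mul_ne_top hF2 (ENNReal.inv_ne_top.2 (by simpa using hε.ne'))

/-- Pointwise Young inequality with a small constant, `1 < p < 2`. -/
theorem mul_rpow_le_add {p : ℝ} (hp : 1 < p) (hp2 : p < 2) {ε : NNReal} (hε : 0 < ε) {h : ℝ≥0∞}
    (h1 : h ≤ 1) (b : ℝ≥0∞) :
    h * b ^ p ≤ h * ((ε : ℝ≥0∞)⁻¹) ^ (p / (2 - p)) + ε * b ^ (2 : ℝ) := by
  have hε0 : (ε : ℝ≥0∞) ≠ 0 := by simpa using hε.ne'
  have hq : 0 < 2 - p := by linarith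
  -- The threshold is `ε b^(2-p) = 1`. Below it, `b^p = (b^(2-p))^(p/(2-p))` is bounded by the
  -- constant.
  rcases le_total 1 (ε * b ^ (2 - p)) with hle | hle
  · calc h * b ^ p ≤ (ε * b ^ (2 - p)) * b ^ p := by gcongr; exact h1.trans hle
      _ = ε * b ^ (2 : ℝ) := by
        rw [mul_assoc, ← ENNReal.rpow_add_of_nonneg _ _ hq.le (by linarith)]; congr 2; ring
      _ ≤ _ := le_add_self
  · have hb : b ^ (2 - p) ≤ (ε : ℝ≥0∞)⁻¹ := by
      simpa using (ENNReal.mul_le_iff_le_inv hε0 ENNReal.coe_ne_top).1 hle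
    calc h * b ^ p = h * (b ^ (2 - p)) ^ (p / (2 - p)) := by
          rw [← ENNReal.rpow_mul]; congr 2; field_simp
      _ ≤ h * ((ε : ℝ≥0∞)⁻¹) ^ (p / (2 - p)) := by
          gcongr
      _ ≤ _ := le_self_add

/-- Since `p < 2`, the `L²` bound controls the large values of `w n`, while the small values are
dominated by a multiple of the integrable weight `h`. This is what makes the Gaussian averages of
the remainders vanish. -/
theorem tendsto_lintegral_mul_rpow_zero {p : ℝ} (hp : 1 < p) (hp2 : p < 2)
    {h : X → ℝ≥0∞} {w : ℕ → X → ℝ≥0∞} {C : ℝ≥0∞} (hC : C ≠ ⊤)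
    (hh : AEMeasurable h μ) (h1 : ∀ x, h x ≤ 1) (hfin : ∫⁻ x, h x ∂μ ≠ ⊤)
    (hw : ∀ n, AEMeasurable (w n) μ) (hwC : ∀ n, ∫⁻ x, w n x ^ (2 : ℝ) ∂μ ≤ C)
    (h0 : ∀ᵐ x ∂μ, Tendsto (fun n => w n x) atTop (𝓝 0)) :
    Tendsto (fun n => ∫⁻ x, h x * w n x ^ p ∂μ) atTop (𝓝 0) := by
  refine tendsto_lintegral_zero_of_le_add (K := fun n x => w n x ^ (2 : ℝ)) hC
    (fun n => hh.mul ((hw n).pow_const p)) (fun n => (hw n).pow_const _) ?_ hwC ?_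
  · filter_upwards [h0] with x hx
    have hpow : Tendsto (fun n => w n x ^ p) atTop (𝓝 0) := by
      have := (ENNReal.continuous_rpow_const (y := p)).tendsto 0 |>.comp hx
      simpa [Function.comp_def, ENNReal.zero_rpow_of_pos (by linarith : 0 < p)] using this
    simpa using ENNReal.Tendsto.const_mul hpow
      (Or.inr ((h1 x).trans_lt ENNReal.one_lt_top).ne)
  · intro ε hε
    refine ⟨fun x => h x * ((ε : ℝ≥0∞)⁻¹) ^ (p / (2 - p)), hh.mul_const _, ?_,
      fun n x => mul_rpow_le_add hp hp2 hε (h1 x) _⟩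
    rw [lintegral_mul_const'' _ hh]
    refine ENNReal.mul_ne_top hfin (ENNReal.rpow_ne_top_of_nonneg ?_ (ENNReal.inv_ne_top.2 (by simpa using hε.ne')))
    exact div_nonneg (by linarith) (by linarith)

/-- The coefficient of `b^p` tends to `1` as `δ → 0`; the loss is put on `a^p`, where `a` will be
the fixed limit function and can serve as a dominating function. -/
theorem add_rpow_le {p : ℝ} (hp : 0 < p) {δ : NNReal} (hδ : 0 < δ) (a b : ℝ≥0∞) :
    (a + b) ^ p ≤ (1 + (δ : ℝ≥0∞)⁻¹) ^ p * a ^ p + (1 + δ : ℝ≥0∞) ^ p * b ^ p := by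
  have hδ0 : (δ : ℝ≥0∞) ≠ 0 := by simpa using hδ.ne'
  rw [← ENNReal.mul_rpow_of_nonneg _ _ hp.le, ← ENNReal.mul_rpow_of_nonneg _ _ hp.le]
  rcases le_total a (δ * b) with h | h
  · calc (a + b) ^ p ≤ ((1 + δ) * b) ^ p := by
          gcongr; rw [add_mul, one_mul, add_comm]; gcongr
      _ ≤ _ := le_add_self
  · have : b ≤ (δ : ℝ≥0∞)⁻¹ * a := by
      rw [← ENNReal.mul_le_iff_le_inv hδ0 ENNReal.coe_ne_top]; exact h
    calc (a + b) ^ p ≤ ((1 + (δ : ℝ≥0∞)⁻¹) * a) ^ p := by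
          gcongr; rw [add_mul, one_mul]; gcongr
      _ ≤ _ := le_self_add

end Measure

end Choquard

/-! ### Quadratic forms whose kernel is a sum of products: semicontinuity and splitting. -/

namespace Choquard

section QuadraticForm

variable {X T : Type*} [MeasurableSpace X] [MeasurableSpace T] {μ : Measure X} {ν : Measure T}
  [SFinite μ] {h : T → X → ℝ≥0∞}

theorem measurable_lintegral_mul (hh : Measurable (Function.uncurry h)) {f : X → ℝ≥0∞}
    (hf : Measurable f) : Measurable fun τ => ∫⁻ x, h τ x * f x ∂μ :=
  Measurable.lintegral_prod_right' (f := fun q : T × X => h q.1 q.2 * f q.2)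
    (hh.mul (hf.comp measurable_snd))

/-- A kernel that factors through a family `h` yields a sum of squares. -/
theorem lintegral_lintegral_kernel_eq [SFinite ν] (hh : Measurable (Function.uncurry h))
    {k : X → X → ℝ≥0∞} (hk : ∀ x, ∀ᵐ y ∂μ, k x y = ∫⁻ τ, h τ x * h τ y ∂ν)
    {f : X → ℝ≥0∞} (hf : Measurable f) :
    ∫⁻ x, (∫⁻ y, k x y * f y ∂μ) * f x ∂μ = ∫⁻ τ, (∫⁻ x, h τ x * f x ∂μ) ^ 2 ∂ν := by
  have hT := measurable_lintegral_mul (μ := μ) hh hf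
  have hx : ∀ x, Measurable fun τ => h τ x := fun x => hh.comp measurable_prodMk_right
  have hτ : ∀ τ, Measurable fun x => h τ x := fun τ => hh.comp measurable_prodMk_left
  have hτf : ∀ τ, Measurable fun x => h τ x * f x := fun τ => (hτ τ).mul hf
  have hxy : ∀ x y, Measurable fun τ => h τ x * h τ y := fun x y => (hx x).mul (hx y)
  have inner : ∀ x, (∫⁻ y, k x y * f y ∂μ) * f x
      = ∫⁻ τ, (∫⁻ y, h τ y * f y ∂μ) * (h τ x * f x) ∂ν := by
    intro x
    have h1 : ∫⁻ y, k x y * f y ∂μ = ∫⁻ y, ∫⁻ τ, h τ x * (h τ y * f y) ∂ν ∂μ := by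
      refine lintegral_congr_ae ?_
      filter_upwards [hk x] with y hy
      rw [hy, ← lintegral_mul_const _ (hxy x y)]
      simp only [mul_assoc]
    rw [h1, lintegral_lintegral_swap, ← lintegral_mul_const]
    · refine lintegral_congr fun τ => ?_
      rw [lintegral_const_mul _ (hτf τ)]
      ring
    · simp_rw [lintegral_const_mul _ (hτf _)]
      exact (hx x).mul hT
    · refine Measurable.aemeasurable ?_
      exact ((hx x).comp measurable_snd).mul
        ((hh.comp (measurable_snd.prodMk measurable_fst)).mul (hf.comp measurable_fst))
  simp_rw [inner]
  rw [lintegral_lintegral_swap]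
  · refine lintegral_congr fun τ => ?_
    rw [lintegral_const_mul _ (hτf τ), sq]
  · refine Measurable.aemeasurable ?_
    exact (hT.comp measurable_snd).mul
        ((hh.comp (measurable_snd.prodMk measurable_fst)).mul (hf.comp measurable_fst))

/-- Lower semicontinuity of the quadratic form under pointwise convergence. -/
theorem lintegral_sq_le_liminf (hh : Measurable (Function.uncurry h))
    {f : X → ℝ≥0∞} {g : ℕ → X → ℝ≥0∞} (hg : ∀ n, Measurable (g n))
    (hlim : ∀ᵐ x ∂μ, Tendsto (fun n => g n x) atTop (𝓝 (f x))) :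
    ∫⁻ τ, (∫⁻ x, h τ x * f x ∂μ) ^ 2 ∂ν
      ≤ liminf (fun n => ∫⁻ τ, (∫⁻ x, h τ x * g n x ∂μ) ^ 2 ∂ν) atTop := by
  have hτ : ∀ τ, Measurable fun x => h τ x := fun τ => hh.comp measurable_prodMk_left
  refine le_trans (lintegral_mono fun τ => ?_)
    (lintegral_liminf_le fun n => (measurable_lintegral_mul (μ := μ) hh (hg n)).pow_const 2)
  have h1 : ∫⁻ x, h τ x * f x ∂μ ≤ liminf (fun n => ∫⁻ x, h τ x * g n x ∂μ) atTop := by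
    refine le_trans (lintegral_mono_ae ?_) (lintegral_liminf_le fun n => (hτ τ).mul (hg n))
    filter_upwards [hlim] with x hx
    -- Here `h τ x` may be infinite, so multiplying the limit by it requires `f x ≠ 0`.
    by_cases h0 : f x = 0
    · simp [h0]
    · exact (ENNReal.Tendsto.const_mul hx (Or.inl h0)).liminf_eq.ge
  have h2 := (ENNReal.continuous_pow 2).continuousAt
    (x := liminf (fun n => ∫⁻ x, h τ x * g n x ∂μ) atTop)
  have hmono : Monotone fun t : ℝ≥0∞ => t ^ 2 := fun a b hab => pow_le_pow_left' hab 2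
  calc (∫⁻ x, h τ x * f x ∂μ) ^ 2 ≤ (liminf (fun n => ∫⁻ x, h τ x * g n x ∂μ) atTop) ^ 2 := by
        gcongr
    _ = _ := hmono.map_liminf_of_continuousAt _ h2

/-- A one-sided Brezis--Lieb lemma for a nonlocal quadratic form. -/
theorem one_le_add_of_frequently_le (hh : Measurable (Function.uncurry h))
    (h1 : ∀ τ x, h τ x ≤ 1) (hint : ∀ᵐ τ ∂ν, ∫⁻ x, h τ x ∂μ ≠ ⊤) {p : ℝ} (hp : 1 < p) (hp2 : p < 2)
    {a b : ℕ → X → ℝ≥0∞} {c : X → ℝ≥0∞} {C C' s : ℝ≥0∞} (hC : C ≠ ⊤) (hC' : C' ≠ ⊤)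
    (ha : ∀ n, Measurable (a n)) (hb : ∀ n, Measurable (b n)) (hc : Measurable c)
    (hcf : ∀ x, c x ≠ ⊤)
    (habc : ∀ n x, a n x ≤ c x + b n x) (hac : ∀ᵐ x ∂μ, Tendsto (fun n => a n x) atTop (𝓝 (c x)))
    (hb0 : ∀ᵐ x ∂μ, Tendsto (fun n => b n x) atTop (𝓝 0))
    (hbC : ∀ n, ∫⁻ x, b n x ^ (2 : ℝ) ∂μ ≤ C)
    (hbQ : ∀ n, ∫⁻ τ, (∫⁻ x, h τ x * b n x ^ p ∂μ) ^ 2 ∂ν ≤ C')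
    (hcQ : ∫⁻ τ, (∫⁻ x, h τ x * c x ^ p ∂μ) ^ 2 ∂ν ≠ ⊤)
    (haQ : ∀ n, ∫⁻ τ, (∫⁻ x, h τ x * a n x ^ p ∂μ) ^ 2 ∂ν = 1)
    (hs : ∃ᶠ n in atTop, ∫⁻ τ, (∫⁻ x, h τ x * b n x ^ p ∂μ) ^ 2 ∂ν ≤ s) :
    1 ≤ ∫⁻ τ, (∫⁻ x, h τ x * c x ^ p ∂μ) ^ 2 ∂ν + s := by
  have hp0 : 0 < p := by linarith
  have hτ : ∀ τ, Measurable fun x => h τ x := fun τ => hh.comp measurable_prodMk_left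
  have hτc : ∀ τ, Measurable fun x => h τ x * c x ^ p := fun τ => (hτ τ).mul (hc.pow_const p)
  have hτb : ∀ n τ, Measurable fun x => h τ x * b n x ^ p :=
    fun n τ => (hτ τ).mul ((hb n).pow_const p)
  set F : T → ℝ≥0∞ := fun τ => ∫⁻ x, h τ x * c x ^ p ∂μ with hF
  set G : ℕ → T → ℝ≥0∞ := fun n τ => ∫⁻ x, h τ x * b n x ^ p ∂μ with hG
  have hFm : Measurable F := measurable_lintegral_mul hh (hc.pow_const p)
  have hGm : ∀ n, Measurable (G n) := fun n => measurable_lintegral_mul hh ((hb n).pow_const p)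
  have hFfin : ∀ᵐ τ ∂ν, F τ ≠ ⊤ := by
    filter_upwards [ae_lt_top (hFm.pow_const 2) hcQ] with τ hτ h
    simp [h] at hτ
  have hG0 : ∀ᵐ τ ∂ν, Tendsto (fun n => G n τ) atTop (𝓝 0) := by
    filter_upwards [hint] with τ hτi
    exact tendsto_lintegral_mul_rpow_zero hp hp2 hC (hτ τ).aemeasurable (h1 τ) hτi
      (fun n => (hb n).aemeasurable) hbC hb0
  have hFG : Tendsto (fun n => ∫⁻ τ, F τ * G n τ ∂ν) atTop (𝓝 0) :=
    tendsto_lintegral_mul_zero hC' hFm.aemeasurable (fun n => (hGm n).aemeasurable) hcQ hbQ hG0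
  -- the estimate for a fixed small parameter
  have key : ∀ δ : NNReal, 0 < δ →
      1 ≤ ∫⁻ τ, F τ ^ 2 ∂ν + ((1 + δ : ℝ≥0∞) ^ p) ^ 2 * s := by
    intro δ hδ
    have hδ0 : (δ : ℝ≥0∞) ≠ 0 := by simpa using hδ.ne'
    set B : ℝ≥0∞ := (1 + δ : ℝ≥0∞) ^ p with hB
    set A : ℝ≥0∞ := (1 + (δ : ℝ≥0∞)⁻¹) ^ p with hA
    have hBt : B ≠ ⊤ := ENNReal.rpow_ne_top_of_nonneg hp0.le (by simp)
    have hAt : A ≠ ⊤ := ENNReal.rpow_ne_top_of_nonneg hp0.le (by simp [hδ.ne'])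
    -- The excess of `a^p` over `c^p + B b^p`, as a truncated difference. It tends to `0` almost
    -- everywhere and is dominated by `A c^p`, so its averages `E n` tend to `0` with domination by
    -- `A F`.
    set e : ℕ → X → ℝ≥0∞ := fun n x => a n x ^ p - (c x ^ p + B * b n x ^ p) with he
    have hem : ∀ n, Measurable (e n) := fun n =>
      ((ha n).pow_const p).sub ((hc.pow_const p).add (((hb n).pow_const p).const_mul B))
    have heA : ∀ n x, e n x ≤ A * c x ^ p := by
      intro n x
      rw [he]
      simp only [tsub_le_iff_right]
      calc a n x ^ p ≤ (c x + b n x) ^ p := by gcongr; exact habc n x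
        _ ≤ A * c x ^ p + B * b n x ^ p := add_rpow_le hp0 hδ _ _
        _ ≤ _ := by gcongr; exact le_add_self
    have he0 : ∀ᵐ x ∂μ, Tendsto (fun n => e n x) atTop (𝓝 0) := by
      filter_upwards [hac] with x hx
      have hcx : c x ^ p ≠ ⊤ := ENNReal.rpow_ne_top_of_nonneg hp0.le (hcf x)
      have h2 : Tendsto (fun n => a n x ^ p - c x ^ p) atTop (𝓝 0) := by
        have := ENNReal.Tendsto.sub (((ENNReal.continuous_rpow_const (y := p)).tendsto _).comp hx)
          (tendsto_const_nhds (x := c x ^ p)) (Or.inl hcx)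
        simpa [Function.comp_def] using this
      exact tendsto_of_tendsto_of_tendsto_of_le_of_le tendsto_const_nhds h2 (fun _ => zero_le)
        (fun n => tsub_le_tsub_left le_self_add _)
    set E : ℕ → T → ℝ≥0∞ := fun n τ => ∫⁻ x, h τ x * e n x ∂μ with hE
    have hEm : ∀ n, Measurable (E n) := fun n => measurable_lintegral_mul hh (hem n)
    have hEA : ∀ n τ, E n τ ≤ A * F τ := by
      intro n τ
      rw [hF, hE]
      simp only
      rw [← lintegral_const_mul _ (hτc τ)]
      refine lintegral_mono fun x => ?_
      calc h τ x * e n x ≤ h τ x * (A * c x ^ p) := by gcongr; exact heA n x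
        _ = _ := by ring
    have hE0 : ∀ᵐ τ ∂ν, Tendsto (fun n => E n τ) atTop (𝓝 0) := by
      filter_upwards [hFfin] with τ hFτ
      have := tendsto_lintegral_of_dominated_convergence (μ := μ) (F := fun n x => h τ x * e n x)
        (f := fun _ => 0)
        (fun x => A * (h τ x * c x ^ p)) (fun n => (hτ τ).mul (hem n))
        (fun n => .of_forall fun x => by
          calc h τ x * e n x ≤ h τ x * (A * c x ^ p) := by gcongr; exact heA n x
            _ = _ := by ring)
        (by rw [lintegral_const_mul _ (hτc τ)]
            exact ENNReal.mul_ne_top hAt hFτ)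
        (by
          filter_upwards [he0] with x hx
          simpa using ENNReal.Tendsto.const_mul hx
            (Or.inr ((h1 τ x).trans_lt ENNReal.one_lt_top).ne))
      simpa using this
    have hR : Tendsto (fun n => ∫⁻ τ, (F τ + E n τ) ^ 2 ∂ν) atTop (𝓝 (∫⁻ τ, F τ ^ 2 ∂ν)) := by
      refine tendsto_lintegral_of_dominated_convergence (fun τ => (1 + A) ^ 2 * F τ ^ 2)
        (fun n => (hFm.add (hEm n)).pow_const 2) (fun n => .of_forall fun τ => ?_) ?_ ?_
      · change (F τ + E n τ) ^ 2 ≤ (1 + A) ^ 2 * F τ ^ 2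
        rw [← mul_pow, add_mul, one_mul]
        gcongr
        exact hEA n τ
      · rw [lintegral_const_mul _ (hFm.pow_const 2)]
        exact ENNReal.mul_ne_top (by simp [hAt]) hcQ
      · filter_upwards [hE0] with τ hτ0
        have h2 : Tendsto (fun n => F τ + E n τ) atTop (𝓝 (F τ)) := by
          simpa using tendsto_const_nhds.add hτ0
        exact ((ENNReal.continuous_pow 2).tendsto _).comp h2
    -- Expand the square of `F + E + B G`. In the cross term `E` is absorbed into `(1 + A) F`,
    -- leaving the vanishing pairing of `F` with `G n`.
    have hbound : ∀ n, 1 ≤ ∫⁻ τ, (F τ + E n τ) ^ 2 ∂ν + 2 * B * (1 + A) * ∫⁻ τ, F τ * G n τ ∂ν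
        + B ^ 2 * ∫⁻ τ, G n τ ^ 2 ∂ν := by
      intro n
      have m1 : Measurable fun τ => F τ * G n τ := hFm.mul (hGm n)
      have m2 : Measurable fun τ => G n τ ^ 2 := (hGm n).pow_const 2
      have m3 : Measurable fun τ => (F τ + E n τ) ^ 2 := (hFm.add (hEm n)).pow_const 2
      rw [← lintegral_const_mul _ m1, ← lintegral_const_mul _ m2, ← lintegral_add_left m3,
        ← lintegral_add_right _ (m2.const_mul _)]
      refine (haQ n).ge.trans ?_
      refine lintegral_mono fun τ => ?_
      have hle : ∫⁻ x, h τ x * a n x ^ p ∂μ ≤ F τ + E n τ + B * G n τ := by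
        rw [hF, hE, hG]
        simp only
        rw [← lintegral_const_mul _ (hτb n τ),
          ← lintegral_add_left (hτc τ), ← lintegral_add_right _
          ((hτb n τ).const_mul _)]
        refine lintegral_mono fun x => ?_
        calc h τ x * a n x ^ p ≤ h τ x * (e n x + (c x ^ p + B * b n x ^ p)) := by
              gcongr; exact le_tsub_add
          _ = _ := by ring
      calc (∫⁻ x, h τ x * a n x ^ p ∂μ) ^ 2 ≤ (F τ + E n τ + B * G n τ) ^ 2 := by gcongr
        _ = (F τ + E n τ) ^ 2 + 2 * B * (F τ + E n τ) * G n τ + B ^ 2 * G n τ ^ 2 := by ring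
        _ ≤ (F τ + E n τ) ^ 2 + 2 * B * (F τ + A * F τ) * G n τ + B ^ 2 * G n τ ^ 2 := by
            gcongr; exact hEA n τ
        _ = _ := by ring
    have hlim : Tendsto (fun n => ∫⁻ τ, (F τ + E n τ) ^ 2 ∂ν
        + 2 * B * (1 + A) * ∫⁻ τ, F τ * G n τ ∂ν + B ^ 2 * s) atTop
        (𝓝 (∫⁻ τ, F τ ^ 2 ∂ν + B ^ 2 * s)) := by
      have h2 : Tendsto (fun n => 2 * B * (1 + A) * ∫⁻ τ, F τ * G n τ ∂ν) atTop (𝓝 0) := by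
        simpa using ENNReal.Tendsto.const_mul hFG (Or.inr (ENNReal.mul_ne_top
          (ENNReal.mul_ne_top (by simp) hBt) (by simp [hAt])) )
      simpa using (hR.add h2).add (tendsto_const_nhds (x := B ^ 2 * s))
    refine ge_of_tendsto_of_frequently hlim (hs.mono fun n hn => (hbound n).trans ?_)
    gcongr
  -- Let `δ = 1/(n+1)` tend to `0`, so that the factor in front of `s` becomes `1`.
  have hδ : Tendsto (fun n : ℕ => ∫⁻ τ, F τ ^ 2 ∂ν
      + ((1 + ((1 / ((n : NNReal) + 1) : NNReal) : ℝ≥0∞)) ^ p) ^ 2 * s) atTop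
      (𝓝 (∫⁻ τ, F τ ^ 2 ∂ν + ((1 + (0 : NNReal) : ℝ≥0∞) ^ p) ^ 2 * s)) := by
    refine tendsto_const_nhds.add (ENNReal.Tendsto.mul_const ?_ (Or.inl ?_))
    · have h3 : Tendsto (fun n : ℕ => (1 + ((1 / ((n : NNReal) + 1) : NNReal) : ℝ≥0∞))) atTop
          (𝓝 (1 + (0 : NNReal) : ℝ≥0∞)) :=
        tendsto_const_nhds.add (ENNReal.tendsto_coe.2 tendsto_one_div_add_atTop_nhds_zero_nat)
      exact ((ENNReal.continuous_pow 2).tendsto _).comp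
        (((ENNReal.continuous_rpow_const (y := p)).tendsto _).comp h3)
    · simp
  have := ge_of_tendsto' hδ fun n => key (1 / ((n : NNReal) + 1)) (by positivity)
  simpa using this

end QuadraticForm

end Choquard

/-! ### Gaussian representation of the Riesz kernel. -/

namespace Choquard

/-- The Gaussian `x ↦ exp (-2 t |x - z|²)`, for `τ = (t, z)`. -/
noncomputable def gaussianBump {N : ℕ} (τ : ℝ × Space N) (x : Space N) : ℝ≥0∞ :=
  ENNReal.ofReal (Real.exp (-(2 * τ.1) * ‖x - τ.2‖ ^ 2))

theorem measurable_gaussianBump {N : ℕ} :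
    Measurable (Function.uncurry (gaussianBump (N := N))) := by
  unfold gaussianBump Function.uncurry
  fun_prop

theorem lintegral_exp_neg_mul_norm_sub_sq {N : ℕ} {b : ℝ} (hb : 0 < b) (z : Space N) :
    ∫⁻ x : Space N, ENNReal.ofReal (Real.exp (-b * ‖x - z‖ ^ 2))
      = ENNReal.ofReal ((Real.pi / b) ^ ((N : ℝ) / 2)) := by
  have hint : Integrable fun v : Space N => Real.exp (-b * ‖v‖ ^ 2) := by
    have h := GaussianFourier.integrable_cexp_neg_mul_sq_norm_add (V := Space N) (b := (b : ℂ))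
      (by simpa using hb) 0 0
    convert h.norm using 2 with v
    simp [Complex.norm_exp, ← Complex.ofReal_pow]
  rw [lintegral_sub_right_eq_self
    (fun x : Space N => ENNReal.ofReal (Real.exp (-b * ‖x‖ ^ 2))) z,
    ← ofReal_integral_eq_lintegral_ofReal hint (.of_forall fun _ => (Real.exp_pos _).le),
    GaussianFourier.integral_rexp_neg_mul_sq_norm hb]
  simp

/-- By the parallelogram law the product is a Gaussian in `z` centred at the midpoint of `x` and
`y`, times a factor depending on `x - y` only. -/
theorem lintegral_gaussianBump_mul {N : ℕ} {t : ℝ} (ht : 0 < t) (x y : Space N) :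
    ∫⁻ z, gaussianBump (t, z) x * gaussianBump (t, z) y
      = ENNReal.ofReal (Real.exp (-(t * ‖x - y‖ ^ 2)) * (Real.pi / (4 * t)) ^ ((N : ℝ) / 2)) := by
  have h : ∀ z : Space N, gaussianBump (t, z) x * gaussianBump (t, z) y
      = ENNReal.ofReal (Real.exp (-(t * ‖x - y‖ ^ 2)))
        * ENNReal.ofReal (Real.exp (-(4 * t) * ‖z - (1 / 2 : ℝ) • (x + y)‖ ^ 2)) := by
    intro z
    unfold gaussianBump
    rw [← ENNReal.ofReal_mul (Real.exp_pos _).le, ← ENNReal.ofReal_mul (Real.exp_pos _).le,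
      ← Real.exp_add, ← Real.exp_add]
    congr 2
    have hp := parallelogram_law_with_norm ℝ (x - z) (y - z)
    have e1 : x - z + (y - z) = (-2 : ℝ) • (z - (1 / 2 : ℝ) • (x + y)) := by module
    have e2 : x - z - (y - z) = x - y := by abel
    rw [e1, e2, norm_smul, Real.norm_eq_abs, abs_neg, abs_two] at hp
    simp only
    linear_combination t * hp
  simp_rw [h]
  rw [lintegral_const_mul' _ _ ENNReal.ofReal_ne_top,
    lintegral_exp_neg_mul_norm_sub_sq (by positivity), ← ENNReal.ofReal_mul (Real.exp_pos _).le]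

theorem lintegral_rpow_mul_exp_neg_mul_Ioi {a r : ℝ} (ha : 0 < a) (hr : 0 < r) :
    ∫⁻ t in Set.Ioi (0 : ℝ), ENNReal.ofReal (t ^ (a - 1) * Real.exp (-(r * t)))
      = ENNReal.ofReal ((1 / r) ^ a * Real.Gamma a) := by
  have h := Real.integral_rpow_mul_exp_neg_mul_Ioi ha hr
  have hpos : 0 < (1 / r) ^ a * Real.Gamma a := by
    have := Real.Gamma_pos_of_pos ha
    positivity
  rw [← h, ofReal_integral_eq_lintegral_ofReal]
  -- Without integrability the Bochner integral would have the default value `0`, but its value is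
  -- positive.
  · by_contra hni
    rw [integral_undef hni] at h
    exact hpos.ne h
  · refine (ae_restrict_iff' measurableSet_Ioi).2 (.of_forall fun t ht => ?_)
    have : (0 : ℝ) < t := ht
    positivity

/-- The constant in the definition of the Riesz potential. -/
noncomputable def rieszConst (N : ℕ) (α : ℝ) : ℝ :=
  Real.Gamma ((N - α) / 2) / (2 ^ α * Real.pi ^ ((N : ℝ) / 2) * Real.Gamma (α / 2))

theorem rieszConst_pos {N : ℕ} {α : ℝ} (h0 : 0 < α) (hN : α < N) : 0 < rieszConst N α := by
  have h1 := Real.Gamma_pos_of_pos (show 0 < ((N : ℝ) - α) / 2 by linarith)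
  have h2 := Real.Gamma_pos_of_pos (show 0 < α / 2 by linarith)
  have := Real.pi_pos
  unfold rieszConst
  positivity

theorem rieszKernel_pos {N : ℕ} {α : ℝ} (h0 : 0 < α) (hN : α < N) {x : Space N} (hx : x ≠ 0) :
    0 < rieszKernel N α x := by
  have h1 := Real.Gamma_pos_of_pos (show 0 < ((N : ℝ) - α) / 2 by linarith)
  have h2 := Real.Gamma_pos_of_pos (show 0 < α / 2 by linarith)
  have := Real.pi_pos
  have hx' := norm_pos_iff.2 hx
  unfold rieszKernel
  positivity

theorem rieszKernel_eq {N : ℕ} {α : ℝ} {x : Space N} (hx : x ≠ 0) :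
    rieszKernel N α x = rieszConst N α * (1 / ‖x‖ ^ 2) ^ (((N : ℝ) - α) / 2) := by
  have hx' := norm_pos_iff.2 hx
  have : (1 / ‖x‖ ^ 2) ^ (((N : ℝ) - α) / 2) = (‖x‖ ^ ((N : ℝ) - α))⁻¹ := by
    rw [one_div, Real.inv_rpow (by positivity), ← Real.rpow_natCast, ← Real.rpow_mul hx'.le]
    congr 2
    push_cast
    ring
  rw [this, rieszKernel, rieszConst, ← div_div, div_eq_mul_inv (_ / _)]

/-- The density in `t` of the measure representing the Riesz kernel by Gaussians. -/
noncomputable def rieszDensity (N : ℕ) (α t : ℝ) : ℝ≥0∞ :=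
  ENNReal.ofReal (rieszConst N α / Real.Gamma (((N : ℝ) - α) / 2)
    * (t ^ (((N : ℝ) - α) / 2 - 1) * ((Real.pi / (4 * t)) ^ ((N : ℝ) / 2))⁻¹))

theorem measurable_rieszDensity (N : ℕ) (α : ℝ) : Measurable (rieszDensity N α) := by
  unfold rieszDensity
  fun_prop

/-- The measure representing the Riesz kernel by Gaussians. -/
noncomputable def rieszMeasure (N : ℕ) (α : ℝ) : Measure (ℝ × Space N) :=
  ((volume.restrict (Set.Ioi (0 : ℝ))).withDensity (rieszDensity N α)).prod volume

instance (N : ℕ) (α : ℝ) : SFinite (rieszMeasure N α) := by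
  unfold rieszMeasure
  infer_instance

theorem ae_rieszMeasure_pos (N : ℕ) (α : ℝ) : ∀ᵐ τ ∂(rieszMeasure N α), 0 < τ.1 := by
  have h : ∀ᵐ t ∂((volume.restrict (Set.Ioi (0 : ℝ))).withDensity (rieszDensity N α)), 0 < t :=
    (withDensity_absolutelyContinuous _ _).ae_le
      ((ae_restrict_iff' measurableSet_Ioi).2 (.of_forall fun t ht => ht))
  exact Measure.quasiMeasurePreserving_fst.ae h

/-- The Gamma integral writes `(|x-y|²)^(-s)`, `s = (N-α)/2`, as a superposition of `exp(-t
|x-y|²)`, and each of these is an integral over `z` of two bumps; the inverse power in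
`rieszDensity` cancels the mass of that integral. On the diagonal the identity fails: the left side
takes the default value `0`, the right side is infinite. -/
theorem ofReal_rieszKernel_eq {N : ℕ} {α : ℝ} (h0 : 0 < α) (hN : α < N) {x y : Space N}
    (hxy : x ≠ y) :
    ENNReal.ofReal (rieszKernel N α (x - y))
      = ∫⁻ τ, gaussianBump τ x * gaussianBump τ y ∂(rieszMeasure N α) := by
  have hs : 0 < ((N : ℝ) - α) / 2 := by linarith
  have hΓ := Real.Gamma_pos_of_pos hs
  have hc := rieszConst_pos h0 hN
  have hr : 0 < ‖x - y‖ ^ 2 := by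
    have := norm_pos_iff.2 (sub_ne_zero.2 hxy)
    positivity
  have hm : ∀ x, Measurable fun τ : ℝ × Space N => gaussianBump τ x := fun x =>
    measurable_gaussianBump.comp measurable_prodMk_right
  have hmm : Measurable fun τ : ℝ × Space N => gaussianBump τ x * gaussianBump τ y :=
    (hm x).mul (hm y)
  have hmi : Measurable fun t : ℝ => ∫⁻ z, gaussianBump (t, z) x * gaussianBump (t, z) y :=
    Measurable.lintegral_prod_right' hmm
  rw [rieszMeasure, lintegral_prod _ hmm.aemeasurable,
    lintegral_withDensity_eq_lintegral_mul _ (measurable_rieszDensity N α) hmi]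
  have : ∀ t ∈ Set.Ioi (0 : ℝ), (rieszDensity N α * fun t : ℝ => ∫⁻ z, gaussianBump (t, z) x *
      gaussianBump (t, z) y) t = ENNReal.ofReal (rieszConst N α / Real.Gamma (((N : ℝ) - α) / 2))
        * ENNReal.ofReal (t ^ (((N : ℝ) - α) / 2 - 1) * Real.exp (-(‖x - y‖ ^ 2 * t))) := by
    intro t ht
    have ht' : 0 < t := ht
    have hpi := Real.pi_pos
    have hq : 0 < (Real.pi / (4 * t)) ^ ((N : ℝ) / 2) := by positivity
    rw [Pi.mul_apply, lintegral_gaussianBump_mul ht', rieszDensity,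
      ← ENNReal.ofReal_mul (by positivity), ← ENNReal.ofReal_mul (by positivity),
      mul_comm (‖x - y‖ ^ 2) t]
    congr 1
    field_simp
  rw [setLIntegral_congr_fun measurableSet_Ioi this,
    lintegral_const_mul' _ _ ENNReal.ofReal_ne_top, lintegral_rpow_mul_exp_neg_mul_Ioi hs hr,
    ← ENNReal.ofReal_mul (by positivity), rieszKernel_eq (sub_ne_zero.2 hxy)]
  congr 1
  field_simp

/-- The nonlocal energy as an integral of squares. -/
theorem nonlocalEnergy_eq {N : ℕ} {α : ℝ} (h0 : 0 < α) (hN : α < N) (u : L2 N) :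
    nonlocalEnergy α u = ∫⁻ τ, (∫⁻ x, gaussianBump τ x * ‖u x‖ₑ ^ (α / N + 1)) ^ 2
      ∂(rieszMeasure N α) := by
  have hN0 : 0 < N := by
    have : (0 : ℝ) < N := h0.trans hN
    exact_mod_cast this
  have : Nontrivial (Space N) := by
    have : Nonempty (Fin N) := ⟨⟨0, hN0⟩⟩
    infer_instance
  have hp : 0 ≤ α / N + 1 := by positivity
  have hf : Measurable fun x => ‖u x‖ₑ ^ (α / N + 1) :=
    (Lp.stronglyMeasurable u).measurable.enorm.pow_const _
  rw [← lintegral_lintegral_kernel_eq measurable_gaussianBump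
    (k := fun x y => ENNReal.ofReal (rieszKernel N α (x - y))) (fun x => ?_) hf]
  · have : ∀ x, ENNReal.ofReal (|u x| ^ (α / N + 1)) = ‖u x‖ₑ ^ (α / N + 1) := by
      intro x
      rw [← ENNReal.ofReal_rpow_of_nonneg (abs_nonneg _) hp, Real.enorm_eq_ofReal_abs]
    simp only [nonlocalEnergy, rieszPotential, this]
  -- For each `x` the excluded diagonal is a single point, which is null because `N ≥ 1`.
  · have : ∀ᵐ y : Space N, y ≠ x := by
      rw [ae_iff]; simp
    filter_upwards [this] with y hy
    exact ofReal_rieszKernel_eq h0 hN hy.symm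

end Choquard

/-! ### Homogeneity, semicontinuity and splitting of the nonlocal energy. -/

namespace Choquard

variable {N : ℕ} {α : ℝ}

theorem one_lt_exponent (h0 : 0 < α) (hN : α < N) : 1 < α / N + 1 := by
  have : (0 : ℝ) < N := h0.trans hN
  have := div_pos h0 this
  linarith

theorem exponent_lt_two (h0 : 0 < α) (hN : α < N) : α / N + 1 < 2 := by
  have : (0 : ℝ) < N := h0.trans hN
  have := (div_lt_one this).2 hN
  linarith

theorem integral_abs_sq_eq (u : L2 N) : ∫ x, |u x| ^ 2 = ‖u‖ ^ 2 := by
  rw [← real_inner_self_eq_norm_sq, L2.inner_def]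
  simp [sq]

theorem lintegral_enorm_sq_eq {F : Type*} [NormedAddCommGroup F]
    (u : Lp F 2 (volume : Measure (Space N))) :
    ∫⁻ x, ‖u x‖ₑ ^ 2 = ‖u‖ₑ ^ 2 := by
  rw [Lp.enorm_def, eLpNorm_eq_lintegral_rpow_enorm_toReal (by simp) (by simp)]
  simp only [ENNReal.toReal_ofNat, ENNReal.rpow_ofNat]
  rw [← ENNReal.rpow_natCast, ← ENNReal.rpow_mul]
  simp

theorem nonlocalEnergy_sub_eq (h0 : 0 < α) (hN : α < N) (u v : L2 N) :
    nonlocalEnergy α (u - v) = ∫⁻ τ, (∫⁻ x, gaussianBump τ x * ‖u x - v x‖ₑ ^ (α / N + 1)) ^ 2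
      ∂(rieszMeasure N α) := by
  rw [nonlocalEnergy_eq h0 hN]
  refine lintegral_congr fun τ => ?_
  congr 1
  refine lintegral_congr_ae ?_
  filter_upwards [Lp.coeFn_sub u v] with x hx
  rw [hx, Pi.sub_apply]

theorem nonlocalEnergy_smul (h0 : 0 < α) (hN : α < N) (c : ℝ) (u : L2 N) :
    nonlocalEnergy α (c • u) = (‖c‖ₑ ^ (α / N + 1)) ^ 2 * nonlocalEnergy α u := by
  have hp := one_lt_exponent h0 hN
  have hm : ∀ τ : ℝ × Space N, Measurable fun x => gaussianBump τ x * ‖u x‖ₑ ^ (α / N + 1) :=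
    fun τ => (measurable_gaussianBump.comp measurable_prodMk_left).mul
      ((Lp.stronglyMeasurable u).measurable.enorm.pow_const _)
  rw [nonlocalEnergy_eq h0 hN, nonlocalEnergy_eq h0 hN, ← lintegral_const_mul _
    ((measurable_lintegral_mul measurable_gaussianBump
      ((Lp.stronglyMeasurable u).measurable.enorm.pow_const _)).pow_const 2)]
  refine lintegral_congr fun τ => ?_
  rw [← mul_pow, ← lintegral_const_mul _ (hm τ)]
  congr 1
  refine lintegral_congr_ae ?_
  filter_upwards [Lp.coeFn_smul c u] with x hx
  rw [hx, Pi.smul_apply, enorm_smul, ENNReal.mul_rpow_of_nonneg _ _ (by linarith)]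
  ring

/-- Supplies the uniform finite bound on the nonlocal energy of the remainders, using only
convexity-type inequalities under the Gaussian averages. -/
theorem nonlocalEnergy_sub_le (h0 : 0 < α) (hN : α < N) (u v : L2 N) :
    nonlocalEnergy α (u - v) ≤
      2 * ((2 : ℝ≥0∞) ^ (α / N + 1)) ^ 2 * (nonlocalEnergy α u + nonlocalEnergy α v) := by
  have hp := one_lt_exponent h0 hN
  have hu := (Lp.stronglyMeasurable u).measurable.enorm.pow_const (α / N + 1)
  have hv := (Lp.stronglyMeasurable v).measurable.enorm.pow_const (α / N + 1)
  have hg : ∀ τ : ℝ × Space N, Measurable fun x => gaussianBump τ x := fun τ =>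
    measurable_gaussianBump.comp measurable_prodMk_left
  have hTu := (measurable_lintegral_mul (μ := volume) measurable_gaussianBump hu).pow_const 2
  have hTv := (measurable_lintegral_mul (μ := volume) measurable_gaussianBump hv).pow_const 2
  rw [nonlocalEnergy_sub_eq h0 hN, nonlocalEnergy_eq h0 hN, nonlocalEnergy_eq h0 hN,
    ← lintegral_add_left hTu, ← lintegral_const_mul' _ _
      (ENNReal.mul_ne_top (by simp) (by simp))]
  refine lintegral_mono fun τ => ?_
  set A := ∫⁻ x, gaussianBump τ x * ‖u x‖ₑ ^ (α / N + 1)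
  set B := ∫⁻ x, gaussianBump τ x * ‖v x‖ₑ ^ (α / N + 1)
  have h1 : ∫⁻ x, gaussianBump τ x * ‖u x - v x‖ₑ ^ (α / N + 1)
      ≤ (2 : ℝ≥0∞) ^ (α / N + 1) * (A + B) := by
    have hmu : Measurable fun x => gaussianBump τ x * ‖u x‖ₑ ^ (α / N + 1) := (hg τ).mul hu
    have hmv : Measurable fun x => gaussianBump τ x * ‖v x‖ₑ ^ (α / N + 1) := (hg τ).mul hv
    rw [← lintegral_add_left hmu, ← lintegral_const_mul' _ _ (by simp)]
    refine lintegral_mono fun x => ?_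
    have h2 := add_rpow_le (p := α / N + 1) (by linarith) (δ := 1) one_pos ‖u x‖ₑ ‖v x‖ₑ
    simp only [ENNReal.coe_one, inv_one, one_add_one_eq_two] at h2
    calc gaussianBump τ x * ‖u x - v x‖ₑ ^ (α / N + 1)
        ≤ gaussianBump τ x * (‖u x‖ₑ + ‖v x‖ₑ) ^ (α / N + 1) := by gcongr; exact enorm_sub_le
      _ ≤ gaussianBump τ x * ((2 : ℝ≥0∞) ^ (α / N + 1) * ‖u x‖ₑ ^ (α / N + 1)
          + (2 : ℝ≥0∞) ^ (α / N + 1) * ‖v x‖ₑ ^ (α / N + 1)) := by gcongr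
      _ = _ := by ring
  calc _ ≤ ((2 : ℝ≥0∞) ^ (α / N + 1) * (A + B)) ^ 2 := by gcongr
    _ = ((2 : ℝ≥0∞) ^ (α / N + 1)) ^ 2 * (A + B) ^ 2 := by ring
    _ ≤ ((2 : ℝ≥0∞) ^ (α / N + 1)) ^ 2 * (2 * (A ^ 2 + B ^ 2)) := by
        gcongr
        have := ENNReal.rpow_add_le_mul_rpow_add_rpow A B (p := 2) (by norm_num)
        norm_num at this
        exact this
    _ = _ := by ring

theorem nonlocalEnergy_le_liminf (h0 : 0 < α) (hN : α < N) {u : L2 N} {v : ℕ → L2 N}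
    (hlim : ∀ᵐ x, Tendsto (fun n => v n x) atTop (𝓝 (u x))) :
    nonlocalEnergy α u ≤ liminf (fun n => nonlocalEnergy α (v n)) atTop := by
  simp_rw [nonlocalEnergy_eq h0 hN]
  refine lintegral_sq_le_liminf measurable_gaussianBump
    (fun n => (Lp.stronglyMeasurable (v n)).measurable.enorm.pow_const _) ?_
  filter_upwards [hlim] with x hx
  exact ((ENNReal.continuous_rpow_const (y := α / N + 1)).tendsto _).comp hx.enorm

theorem lintegral_gaussianBump_ne_top {τ : ℝ × Space N} (hτ : 0 < τ.1) :
    ∫⁻ x, gaussianBump τ x ≠ ⊤ := by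
  unfold gaussianBump
  rw [lintegral_exp_neg_mul_norm_sub_sq (by positivity)]
  exact ENNReal.ofReal_ne_top

theorem gaussianBump_le_one {τ : ℝ × Space N} (hτ : 0 ≤ τ.1) (x : Space N) :
    gaussianBump τ x ≤ 1 := by
  unfold gaussianBump
  rw [ENNReal.ofReal_le_one, Real.exp_le_one_iff, neg_mul, neg_nonpos]
  positivity

/-- The one-sided Brezis--Lieb lemma for the nonlocal energy. -/
theorem one_le_nonlocalEnergy_add (h0 : 0 < α) (hN : α < N) {u : L2 N} {v : ℕ → L2 N} {R : ℝ}
    (hR : ∀ n, ‖v n - u‖ ≤ R) (hv : ∀ n, nonlocalEnergy α (v n) = 1)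
    (hlim : ∀ᵐ x, Tendsto (fun n => v n x) atTop (𝓝 (u x))) {s : ℝ≥0∞}
    (hs : ∃ᶠ n in atTop, nonlocalEnergy α (v n - u) ≤ s) : 1 ≤ nonlocalEnergy α u + s := by
  have hp := one_lt_exponent h0 hN
  have hp2 := exponent_lt_two h0 hN
  have hu1 : nonlocalEnergy α u ≤ 1 := by
    simpa [hv] using nonlocalEnergy_le_liminf h0 hN hlim
  have hC' : ∀ n, nonlocalEnergy α (v n - u) ≤ 2 * ((2 : ℝ≥0∞) ^ (α / N + 1)) ^ 2 * (1 + 1) := by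
    intro n
    refine (nonlocalEnergy_sub_le h0 hN _ _).trans ?_
    rw [hv n]
    gcongr
  simp_rw [nonlocalEnergy_sub_eq h0 hN] at hs hC'
  simp_rw [nonlocalEnergy_eq h0 hN] at hv
  rw [nonlocalEnergy_eq h0 hN] at hu1 ⊢
  have hmv : ∀ n, Measurable (v n) := fun n => (Lp.stronglyMeasurable (v n)).measurable
  have hmu : Measurable u := (Lp.stronglyMeasurable u).measurable
  -- replace the bump by one that is bounded by one everywhere
  set h : ℝ × Space N → Space N → ℝ≥0∞ := fun τ x => min (gaussianBump τ x) 1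
  have hh : Measurable (Function.uncurry h) := measurable_gaussianBump.min measurable_const
  have hEq : ∀ f : Space N → ℝ≥0∞, ∫⁻ τ, (∫⁻ x, gaussianBump τ x * f x) ^ 2 ∂(rieszMeasure N α)
      = ∫⁻ τ, (∫⁻ x, h τ x * f x) ^ 2 ∂(rieszMeasure N α) := by
    intro f
    refine lintegral_congr_ae ?_
    filter_upwards [ae_rieszMeasure_pos N α] with τ hτ
    simp only [h, min_eq_left (gaussianBump_le_one hτ.le _)]
  simp_rw [hEq] at hs hC' hv hu1 ⊢
  refine one_le_add_of_frequently_le hh (fun _ _ => min_le_right _ _) ?_ hp hp2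
    (a := fun n x => ‖v n x‖ₑ) (b := fun n x => ‖v n x - u x‖ₑ) (c := fun x => ‖u x‖ₑ)
    (C := ENNReal.ofReal R ^ 2) (by simp) ?_ (fun n => (hmv n).enorm)
    (fun n => ((hmv n).sub hmu).enorm) hmu.enorm (fun _ => enorm_ne_top) (fun n x => ?_) ?_ ?_
    (fun n => ?_) hC' (hu1.trans_lt ENNReal.one_lt_top).ne hv hs
  · filter_upwards [ae_rieszMeasure_pos N α] with τ hτ
    exact ((lintegral_mono fun x => min_le_left _ _).trans_lt
      (lintegral_gaussianBump_ne_top hτ).lt_top).ne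
  · exact ENNReal.mul_ne_top (ENNReal.mul_ne_top (by simp) (by simp)) (by simp)
  · calc ‖v n x‖ₑ = ‖u x + (v n x - u x)‖ₑ := by rw [add_sub_cancel]
      _ ≤ _ := enorm_add_le _ _
  · filter_upwards [hlim] with x hx using hx.enorm
  · filter_upwards [hlim] with x hx
    simpa using (hx.sub_const (u x)).enorm
  · have : ∫⁻ x, ‖v n x - u x‖ₑ ^ (2 : ℝ) = ‖v n - u‖ₑ ^ 2 := by
      rw [← lintegral_enorm_sq_eq]
      refine lintegral_congr_ae ?_
      filter_upwards [Lp.coeFn_sub (v n) u] with x hx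
      rw [hx, Pi.sub_apply]
      norm_num
    rw [this, ← ofReal_norm]
    gcongr
    exact hR n

/-- One vanishing Gaussian average suffices, as a Gaussian is positive everywhere. Such a `τ` exists
because the representing measure is nonzero, the Riesz kernel being positive. -/
theorem eq_zero_of_nonlocalEnergy_eq_zero (h0 : 0 < α) (hN : α < N) {u : L2 N}
    (hu : nonlocalEnergy α u = 0) : u = 0 := by
  have hp := one_lt_exponent h0 hN
  rw [nonlocalEnergy_eq h0 hN] at hu
  have hmu : Measurable fun x => ‖u x‖ₑ ^ (α / N + 1) :=
    (Lp.stronglyMeasurable u).measurable.enorm.pow_const _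
  rw [lintegral_eq_zero_iff
    ((measurable_lintegral_mul (μ := volume) measurable_gaussianBump hmu).pow_const 2)] at hu
  have hne : rieszMeasure N α ≠ 0 := by
    intro h
    have hN0 : 0 < N := by
      have : (0 : ℝ) < N := h0.trans hN
      exact_mod_cast this
    have : Nonempty (Fin N) := ⟨⟨0, hN0⟩⟩
    obtain ⟨x, hx⟩ := exists_ne (0 : Space N)
    have := ofReal_rieszKernel_eq h0 hN hx
    rw [h, lintegral_zero_measure, ENNReal.ofReal_eq_zero, sub_zero] at this
    exact absurd (rieszKernel_pos h0 hN hx) this.not_gt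
  have : (ae (rieszMeasure N α)).NeBot := ae_neBot.2 hne
  obtain ⟨τ, hτ⟩ := hu.exists
  have hτ' : ∫⁻ x, gaussianBump τ x * ‖u x‖ₑ ^ (α / N + 1) = 0 := by simpa using hτ
  have hm : Measurable fun x => gaussianBump τ x * ‖u x‖ₑ ^ (α / N + 1) :=
    (measurable_gaussianBump.comp measurable_prodMk_left).mul hmu
  rw [lintegral_eq_zero_iff hm] at hτ'
  rw [Lp.eq_zero_iff_ae_eq_zero]
  filter_upwards [hτ'] with x hx
  have hpos : gaussianBump τ x ≠ 0 := by simp [gaussianBump, Real.exp_pos]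
  have h2 : ‖u x‖ₑ ^ (α / N + 1) = 0 := by
    simpa [hpos] using hx
  rw [ENNReal.rpow_eq_zero_iff_of_pos (by linarith)] at h2
  simpa using h2

end Choquard

/-! ### Translation estimate for functions with a weak gradient. -/

namespace Choquard

variable {N : ℕ}

/-- The directional derivative of `u ⋆ φ` is controlled by the weak gradient of `u`. -/
theorem abs_integral_mul_fderiv_comp_sub_le {u : L2 N} {g : L2Field N} (hu : IsWeakGradient u g)
    {φ : Space N → ℝ} (hφ : ContDiff ℝ ∞ φ) (hc : HasCompactSupport φ) (y v : Space N) :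
    |∫ x, u x * fderiv ℝ φ (y - x) v| ≤ ‖g‖ * (eLpNorm φ 2 volume).toReal * ‖v‖ := by
  -- The reflected translate is the test function; the sign from the chain rule cancels the one in
  -- the definition of the weak gradient.
  set ψ : Space N → ℝ := fun x => φ (y - x) with hψdef
  have hψ : ContDiff ℝ ∞ ψ := hφ.comp (contDiff_const.sub contDiff_id)
  have hψc : HasCompactSupport ψ := hc.comp_homeomorph (Homeomorph.subLeft y)
  have hder : ∀ x, fderiv ℝ ψ x v = - fderiv ℝ φ (y - x) v := by
    intro x
    have h1 : HasFDerivAt ψ ((fderiv ℝ φ (y - x)).comp (-ContinuousLinearMap.id ℝ (Space N))) x := by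
      have h2 : HasFDerivAt (fun x : Space N => y - x) (-ContinuousLinearMap.id ℝ (Space N)) x :=
        (hasFDerivAt_id x).const_sub y
      exact ((hφ.differentiable (by simp) (y - x)).hasFDerivAt).comp x h2
    rw [h1.fderiv]
    simp
  have hweak := hu ψ hψ hψc v
  simp only [hder, mul_neg, integral_neg, neg_inj] at hweak
  have hφm : MemLp φ 2 volume := hφ.continuous.memLp_of_hasCompactSupport hc
  have hψn : eLpNorm ψ 2 volume = eLpNorm φ 2 volume :=
    eLpNorm_comp_measurePreserving hφm.aestronglyMeasurable (Measure.measurePreserving_sub_left _ y)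
  have hψm : MemLp ψ 2 volume := hψ.continuous.memLp_of_hasCompactSupport hψc
  have hΦ : MemLp (fun x => ψ x • v) 2 volume :=
    (hψ.continuous.smul continuous_const).memLp_of_hasCompactSupport hψc.smul_right
  have hin : ∫ x, inner ℝ (g x) v * ψ x = inner ℝ g hΦ.toLp := by
    rw [L2.inner_def]
    refine integral_congr_ae ?_
    filter_upwards [hΦ.coeFn_toLp] with x hx
    rw [hx, real_inner_smul_right, mul_comm]
  have hnorm : ‖hΦ.toLp‖ ≤ (eLpNorm φ 2 volume).toReal * ‖v‖ := by
    rw [Lp.norm_toLp, ← hψn]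
    have := eLpNorm_le_mul_eLpNorm_of_ae_le_mul (μ := volume) (f := fun x => ψ x • v) (g := ψ)
      (c := ‖v‖) (.of_forall fun x => by rw [norm_smul, mul_comm]) 2
    refine (ENNReal.toReal_mono (ENNReal.mul_ne_top ENNReal.ofReal_ne_top hψm.2.ne) this).trans ?_
    rw [ENNReal.toReal_mul, ENNReal.toReal_ofReal (norm_nonneg _), mul_comm]
  rw [hweak, hin, mul_assoc]
  exact (abs_real_inner_le_norm _ _).trans (by gcongr)

/-- Mean value inequality for the smooth function `u ⋆ φ`, whose derivative is bounded by the
preceding estimate. -/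
theorem abs_integral_sub_le {u : L2 N} {g : L2Field N} (hu : IsWeakGradient u g)
    {φ : Space N → ℝ} (hφ : ContDiff ℝ ∞ φ) (hc : HasCompactSupport φ) (h : Space N) :
    |(∫ x, u x * φ (h - x)) - ∫ x, u x * φ (0 - x)|
      ≤ ‖g‖ * (eLpNorm φ 2 volume).toReal * ‖h‖ := by
  set L := ContinuousLinearMap.mul ℝ ℝ
  have hloc : LocallyIntegrable u volume := (Lp.memLp u).locallyIntegrable (by norm_num)
  have hd : ∀ y, HasFDerivAt (convolution u φ L volume)
      (convolution u (fderiv ℝ φ) (L.precompR (Space N)) volume y) y := fun y =>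
    hc.hasFDerivAt_convolution_right L hloc (hφ.of_le (by simp)) y
  have hval : ∀ y v, (convolution u (fderiv ℝ φ) (L.precompR (Space N)) volume y) v
      = ∫ x, u x * fderiv ℝ φ (y - x) v := by
    intro y v
    have hci := (hc.fderiv (𝕜 := ℝ)).convolutionExists_right (L.precompR (Space N)) hloc
      (hφ.continuous_fderiv (by simp)) y
    rw [convolution, ContinuousLinearMap.integral_apply hci]
    rfl
  have hbound : ∀ y, ‖convolution u (fderiv ℝ φ) (L.precompR (Space N)) volume y‖
      ≤ ‖g‖ * (eLpNorm φ 2 volume).toReal := by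
    intro y
    refine ContinuousLinearMap.opNorm_le_bound _ (by positivity) fun v => ?_
    rw [hval, Real.norm_eq_abs]
    exact abs_integral_mul_fderiv_comp_sub_le hu hφ hc y v
  have := (convex_univ (𝕜 := ℝ) (E := Space N)).norm_image_sub_le_of_norm_hasFDerivWithin_le
    (fun y _ => (hd y).hasFDerivWithinAt) (fun y _ => hbound y) (Set.mem_univ 0) (Set.mem_univ h)
  simpa [convolution, L] using this

/-- The `L²` modulus of continuity of an `H¹` function under translations. -/
theorem lintegral_translation_sub_sq_le {u : L2 N} {g : L2Field N} (hu : IsWeakGradient u g)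
    (h : Space N) : ∫⁻ x, ‖u (x + h) - u x‖ₑ ^ 2 ≤ (‖g‖ₑ * ‖h‖ₑ) ^ 2 := by
  have hmp := measurePreserving_add_right (volume : Measure (Space N)) h
  set d : L2 N := Lp.compMeasurePreserving (· + h) hmp u - u with hd
  have hdx : ∀ᵐ x, d x = u (x + h) - u x := by
    filter_upwards [Lp.coeFn_sub (Lp.compMeasurePreserving (· + h) hmp u) u,
      Lp.coeFn_compMeasurePreserving u hmp] with x hx hx2
    rw [hd, hx, Pi.sub_apply, hx2, Function.comp_apply]
  -- Duality: the bound is proved against test functions, which are dense in `L²`, and is afterwards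
  -- applied to `Φ = d`.
  have hall : ∀ Φ : L2 N, |inner ℝ d Φ| ≤ ‖g‖ * ‖h‖ * ‖Φ‖ := by
    intro Φ
    have hdense := Lp.dense_hasCompactSupport_contDiff (F := ℝ) (p := 2)
      (μ := (volume : Measure (Space N))) (by simp)
    have hcl : IsClosed {Φ : L2 N | |inner ℝ d Φ| ≤ ‖g‖ * ‖h‖ * ‖Φ‖} :=
      isClosed_le (by fun_prop) (by fun_prop)
    refine closure_minimal ?_ hcl (hdense Φ)
    rintro Φ ⟨φ, hΦφ, hc, hφ⟩
    -- Reflecting `φ` turns pairings with translates of `u` into values of a convolution.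
    set φn : Space N → ℝ := fun x => φ (-x)
    have hφn : ContDiff ℝ ∞ φn := hφ.comp contDiff_neg
    have hcn : HasCompactSupport φn := hc.comp_homeomorph (Homeomorph.neg _)
    have hφm : MemLp φ 2 volume := hφ.continuous.memLp_of_hasCompactSupport hc
    have hn : eLpNorm φn 2 volume = eLpNorm φ 2 volume :=
      eLpNorm_comp_measurePreserving hφm.aestronglyMeasurable (Measure.measurePreserving_neg _)
    have hΦn : ‖Φ‖ = (eLpNorm φ 2 volume).toReal := by
      rw [Lp.norm_def, eLpNorm_congr_ae hΦφ]
    have key := abs_integral_sub_le hu hφn hcn h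
    have hT : MemLp (fun x => u (x + h)) 2 volume := (Lp.memLp u).comp_measurePreserving hmp
    have e1 : ∫ x, u x * φn (h - x) = ∫ x, u (x + h) * φ x := by
      rw [← integral_add_right_eq_self _ h]
      refine integral_congr_ae (.of_forall fun x => ?_)
      simp [φn]
    have e2 : ∫ x, u x * φn (0 - x) = ∫ x, u x * φ x := by simp [φn]
    have e3 : inner ℝ d Φ = (∫ x, u (x + h) * φ x) - ∫ x, u x * φ x := by
      have i1 : Integrable fun x => u (x + h) * φ x := hT.integrable_mul hφm
      have i2 : Integrable fun x => u x * φ x := (Lp.memLp u).integrable_mul hφm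
      rw [← integral_sub i1 i2, L2.inner_def]
      refine integral_congr_ae ?_
      filter_upwards [hdx, hΦφ] with x hx hx2
      simp [hx, hx2]
      ring
    change |inner ℝ d Φ| ≤ _
    rw [e3, ← e1, ← e2, hΦn, ← hn]
    exact key.trans (by ring_nf; rfl)
  have hdn : ‖d‖ ≤ ‖g‖ * ‖h‖ := by
    have h1 := hall d
    rw [real_inner_self_eq_norm_sq, abs_of_nonneg (by positivity), sq] at h1
    rcases (norm_nonneg d).eq_or_lt with h2 | h2
    · rw [← h2]; positivity
    · exact le_of_mul_le_mul_right h1 h2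
  calc ∫⁻ x, ‖u (x + h) - u x‖ₑ ^ 2 = ∫⁻ x, ‖d x‖ₑ ^ 2 := by
        refine lintegral_congr_ae ?_
        filter_upwards [hdx] with x hx
        rw [hx]
    _ = ‖d‖ₑ ^ 2 := lintegral_enorm_sq_eq d
    _ ≤ (‖g‖ₑ * ‖h‖ₑ) ^ 2 := by
        gcongr
        rw [← ofReal_norm, ← ofReal_norm g, ← ofReal_norm h, ← ENNReal.ofReal_mul (norm_nonneg _)]
        exact ENNReal.ofReal_le_ofReal hdn

end Choquard

/-! ### A local Rellich theorem by averaging over small balls. -/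

namespace Choquard

variable {N : ℕ}

theorem sq_lintegral_le {X : Type*} [MeasurableSpace X] {μ : Measure X} {f : X → ℝ≥0∞}
    (hf : AEMeasurable f μ) : (∫⁻ x, f x ∂μ) ^ 2 ≤ μ Set.univ * ∫⁻ x, f x ^ 2 ∂μ := by
  have h := ENNReal.lintegral_mul_le_Lp_mul_Lq μ Real.HolderConjugate.two_two hf
    (aemeasurable_const (b := (1 : ℝ≥0∞)))
  simp only [Pi.mul_apply, mul_one, one_pow, lintegral_const, one_mul, ENNReal.rpow_ofNat] at h
  calc (∫⁻ x, f x ∂μ) ^ 2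
      ≤ ((∫⁻ x, f x ^ 2 ∂μ) ^ ((1 : ℝ) / 2) * μ Set.univ ^ ((1 : ℝ) / 2)) ^ 2 := by gcongr
    _ = _ := by
      rw [mul_pow, ← ENNReal.rpow_natCast, ← ENNReal.rpow_natCast, ← ENNReal.rpow_mul,
        ← ENNReal.rpow_mul, mul_comm]
      norm_num

theorem add_sq_le_two_mul (a b : ℝ≥0∞) : (a + b) ^ 2 ≤ 2 * (a ^ 2 + b ^ 2) := by
  have := ENNReal.rpow_add_le_mul_rpow_add_rpow a b (p := 2) (by norm_num)
  norm_num at this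
  exact this

/-- The integral of `u` over the ball of radius `r` around `x`. -/
noncomputable def ballIntegral (u : L2 N) (r : ℝ) (x : Space N) : ℝ :=
  ∫ h in Metric.ball (0 : Space N) r, u (x + h)

/-- As a pairing with an indicator, the ball integral converges pointwise along weakly convergent
sequences. -/
theorem ballIntegral_eq_inner (u : L2 N) (r : ℝ) (x : Space N) :
    ballIntegral u r x = inner ℝ (indicatorConstLp 2 (Metric.isOpen_ball (x := x) (ε := r)).measurableSet
      (measure_ball_lt_top (μ := volume)).ne (1 : ℝ)) u := by
  have h := (measurePreserving_add_left volume x).setIntegral_preimage_emb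
    (measurableEmbedding_addLeft x) u (Metric.ball x r)
  rw [L2.inner_indicatorConstLp_one, ballIntegral, ← h]
  congr 2
  ext h
  simp

theorem measurable_ballIntegral (u : L2 N) (r : ℝ) : Measurable (ballIntegral u r) := by
  have hu : Measurable u := (Lp.stronglyMeasurable u).measurable
  have h : StronglyMeasurable fun q : Space N × Space N => u (q.1 + q.2) :=
    (hu.comp measurable_add).stronglyMeasurable
  exact h.integral_prod_right'.measurable

theorem abs_ballIntegral_le (u : L2 N) (r : ℝ) (x : Space N) :
    |ballIntegral u r x| ≤ (volume.real (Metric.ball (0 : Space N) r)) ^ (1 / 2 : ℝ) * ‖u‖ := by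
  rw [ballIntegral_eq_inner]
  refine (abs_real_inner_le_norm _ _).trans ?_
  rw [norm_indicatorConstLp (by simp) (by simp)]
  simp [measureReal_def, Measure.addHaar_ball_center]

/-- Multiply `u x` by the volume of the ball and compare with the ball integral; Cauchy–Schwarz on
the ball handles the difference. -/
theorem sq_mul_enorm_sq_le (u : L2 N) {r : ℝ} (x : Space N) :
    volume (Metric.ball (0 : Space N) r) ^ 2 * ‖u x‖ₑ ^ 2 ≤ 2 * (‖ballIntegral u r x‖ₑ ^ 2 +
      volume (Metric.ball (0 : Space N) r) *
        ∫⁻ h in Metric.ball (0 : Space N) r, ‖u (x + h) - u x‖ₑ ^ 2) := by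
  set B := Metric.ball (0 : Space N) r
  have hB : volume B ≠ ⊤ := measure_ball_lt_top.ne
  have hu : Measurable u := (Lp.stronglyMeasurable u).measurable
  have hm : Measurable fun h => u (x + h) - u x :=
    (hu.comp (measurable_const_add x)).sub measurable_const
  have : IsFiniteMeasure (volume.restrict B) := ⟨by simpa using hB.lt_top⟩
  have hint : IntegrableOn (fun h => u (x + h)) B := by
    have h2 : MemLp (fun h => u (x + h)) 2 volume :=
      (Lp.memLp u).comp_measurePreserving (measurePreserving_add_left volume x)
    exact (h2.restrict B).integrable (by norm_num)
  have hsplit : volume.real B * u x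
      = ballIntegral u r x - ∫ h in B, (u (x + h) - u x) := by
    rw [integral_sub hint (integrable_const _), ballIntegral]
    simp [B]
  have h1 : volume B * ‖u x‖ₑ ≤ ‖ballIntegral u r x‖ₑ + ∫⁻ h in B, ‖u (x + h) - u x‖ₑ := by
    calc volume B * ‖u x‖ₑ = ‖volume.real B * u x‖ₑ := by
          rw [enorm_mul, Real.enorm_of_nonneg measureReal_nonneg, ofReal_measureReal hB]
      _ ≤ ‖ballIntegral u r x‖ₑ + ‖∫ h in B, (u (x + h) - u x)‖ₑ := by
          rw [hsplit]; exact enorm_sub_le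
      _ ≤ _ := by gcongr; exact enorm_integral_le_lintegral_enorm _
  calc volume B ^ 2 * ‖u x‖ₑ ^ 2 = (volume B * ‖u x‖ₑ) ^ 2 := by rw [mul_pow]
    _ ≤ (‖ballIntegral u r x‖ₑ + ∫⁻ h in B, ‖u (x + h) - u x‖ₑ) ^ 2 := by gcongr
    _ ≤ 2 * (‖ballIntegral u r x‖ₑ ^ 2 + (∫⁻ h in B, ‖u (x + h) - u x‖ₑ) ^ 2) :=
        add_sq_le_two_mul _ _
    _ ≤ _ := by
        gcongr
        simpa using sq_lintegral_le (μ := volume.restrict B) hm.enorm.aemeasurable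

/-- Integrate the pointwise comparison and exchange the integrals. The translation estimate bounds
the error by `O(r²)` uniformly in the weight, and the averaged term is the compact part. -/
theorem lintegral_enorm_sq_mul_le {u : L2 N} {g : L2Field N} (hu : IsWeakGradient u g)
    {m : Space N → ℝ≥0∞} (hm : Measurable m) (hm1 : ∀ x, m x ≤ 1) {r : ℝ} (hr : 0 < r) :
    ∫⁻ x, ‖u x‖ₑ ^ 2 * m x ≤
      2 * (volume (Metric.ball (0 : Space N) r) ^ 2)⁻¹ * (∫⁻ x, ‖ballIntegral u r x‖ₑ ^ 2 * m x)
        + 2 * (‖g‖ₑ * ENNReal.ofReal r) ^ 2 := by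
  set B := Metric.ball (0 : Space N) r
  set β := volume B
  have hB : β ≠ ⊤ := measure_ball_lt_top.ne
  have hB0 : β ≠ 0 := (Metric.measure_ball_pos _ _ hr).ne'
  have hum : Measurable u := (Lp.stronglyMeasurable u).measurable
  have hjoint : Measurable fun q : Space N × Space N => ‖u (q.1 + q.2) - u q.1‖ₑ ^ 2 :=
    (((hum.comp measurable_add).sub (hum.comp measurable_fst)).enorm).pow_const 2
  have hinner : Measurable fun x => ∫⁻ h in B, ‖u (x + h) - u x‖ₑ ^ 2 :=
    Measurable.lintegral_prod_right' hjoint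
  have hbm : Measurable fun x => ‖ballIntegral u r x‖ₑ ^ 2 * m x :=
    ((measurable_ballIntegral u r).enorm.pow_const 2).mul hm
  have hdouble : ∫⁻ x, ∫⁻ h in B, ‖u (x + h) - u x‖ₑ ^ 2
      ≤ β * (‖g‖ₑ * ENNReal.ofReal r) ^ 2 := by
    rw [lintegral_lintegral_swap hjoint.aemeasurable]
    calc ∫⁻ h in B, ∫⁻ x, ‖u (x + h) - u x‖ₑ ^ 2
        ≤ ∫⁻ h in B, (‖g‖ₑ * ENNReal.ofReal r) ^ 2 := by
          refine setLIntegral_mono' Metric.isOpen_ball.measurableSet fun h hh => ?_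
          refine (lintegral_translation_sub_sq_le hu h).trans ?_
          gcongr
          rw [← ofReal_norm]
          exact ENNReal.ofReal_le_ofReal (by simpa using (mem_ball_zero_iff.1 hh).le)
      _ = _ := by rw [setLIntegral_const, mul_comm]
  have hpt : ∀ x, ‖u x‖ₑ ^ 2 * m x ≤ 2 * (β ^ 2)⁻¹ * (‖ballIntegral u r x‖ₑ ^ 2 * m x)
      + 2 * β⁻¹ * ∫⁻ h in B, ‖u (x + h) - u x‖ₑ ^ 2 := by
    intro x
    have h1 := sq_mul_enorm_sq_le u (r := r) x
    have hβ : (β ^ 2)⁻¹ * β ^ 2 = 1 := ENNReal.inv_mul_cancel (by simpa using hB0) (by simp [hB])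
    have hββ : (β ^ 2)⁻¹ * β = β⁻¹ := by
      rw [sq, ENNReal.mul_inv (Or.inl hB0) (Or.inl hB), mul_assoc, ENNReal.inv_mul_cancel hB0 hB,
        mul_one]
    set I := ∫⁻ h in B, ‖u (x + h) - u x‖ₑ ^ 2
    set b := ‖ballIntegral u r x‖ₑ ^ 2
    calc ‖u x‖ₑ ^ 2 * m x = (β ^ 2)⁻¹ * (β ^ 2 * ‖u x‖ₑ ^ 2) * m x := by
          rw [← mul_assoc (β ^ 2)⁻¹, hβ, one_mul]
      _ ≤ (β ^ 2)⁻¹ * (2 * (b + β * I)) * m x := by gcongr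
      _ = 2 * (β ^ 2)⁻¹ * (b * m x) + 2 * ((β ^ 2)⁻¹ * β) * (I * m x) := by ring
      _ ≤ 2 * (β ^ 2)⁻¹ * (b * m x) + 2 * β⁻¹ * (I * 1) := by
          rw [hββ]; gcongr; exact hm1 x
      _ = _ := by rw [mul_one]
  calc ∫⁻ x, ‖u x‖ₑ ^ 2 * m x ≤ ∫⁻ x, (2 * (β ^ 2)⁻¹ * (‖ballIntegral u r x‖ₑ ^ 2 * m x)
      + 2 * β⁻¹ * ∫⁻ h in B, ‖u (x + h) - u x‖ₑ ^ 2) := lintegral_mono hpt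
    _ = 2 * (β ^ 2)⁻¹ * (∫⁻ x, ‖ballIntegral u r x‖ₑ ^ 2 * m x)
      + 2 * β⁻¹ * ∫⁻ x, ∫⁻ h in B, ‖u (x + h) - u x‖ₑ ^ 2 := by
        rw [lintegral_add_left (hbm.const_mul _), lintegral_const_mul _ hbm,
          lintegral_const_mul _ hinner]
    _ ≤ 2 * (β ^ 2)⁻¹ * (∫⁻ x, ‖ballIntegral u r x‖ₑ ^ 2 * m x)
      + 2 * β⁻¹ * (β * (‖g‖ₑ * ENNReal.ofReal r) ^ 2) := by gcongr
    _ = _ := by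
        congr 1
        rw [mul_assoc, ← mul_assoc β⁻¹, ENNReal.inv_mul_cancel hB0 hB, one_mul]

/-- A Rellich-type theorem: bounded sequences in `H¹` which converge weakly to zero in `L²`
converge strongly to zero in `L²` with respect to finite weights. -/
theorem tendsto_lintegral_enorm_sq_mul {w : ℕ → L2 N} {g : ℕ → L2Field N}
    (hw : ∀ n, IsWeakGradient (w n) (g n)) {R : ℝ} (hwR : ∀ n, ‖w n‖ ≤ R) (hgR : ∀ n, ‖g n‖ ≤ R)
    (hweak : ∀ ψ : L2 N, Tendsto (fun n => inner ℝ ψ (w n)) atTop (𝓝 0))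
    {m : Space N → ℝ≥0∞} (hm : Measurable m) (hm1 : ∀ x, m x ≤ 1) (hmi : ∫⁻ x, m x ≠ ⊤) :
    Tendsto (fun n => ∫⁻ x, ‖w n x‖ₑ ^ 2 * m x) atTop (𝓝 0) := by
  have hR : 0 ≤ R := (norm_nonneg _).trans (hwR 0)
  have hball : ∀ r, Tendsto (fun n => ∫⁻ x, ‖ballIntegral (w n) r x‖ₑ ^ 2 * m x) atTop (𝓝 0) := by
    intro r
    set K : ℝ := (volume.real (Metric.ball (0 : Space N) r)) ^ (1 / 2 : ℝ) * R
    have := tendsto_lintegral_of_dominated_convergence (μ := (volume : Measure (Space N)))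
      (F := fun n x => ‖ballIntegral (w n) r x‖ₑ ^ 2 * m x) (f := fun _ => 0)
      (fun x => ENNReal.ofReal K ^ 2 * m x)
      (fun n => ((measurable_ballIntegral (w n) r).enorm.pow_const 2).mul hm)
      (fun n => .of_forall fun x => ?_) ?_ (.of_forall fun x => ?_)
    · simpa using this
    · change ‖ballIntegral (w n) r x‖ₑ ^ 2 * m x ≤ ENNReal.ofReal K ^ 2 * m x
      gcongr
      rw [Real.enorm_eq_ofReal_abs]
      refine ENNReal.ofReal_le_ofReal ((abs_ballIntegral_le _ _ _).trans ?_)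
      exact mul_le_mul_of_nonneg_left (hwR n) (by positivity)
    · rw [lintegral_const_mul _ hm]
      exact ENNReal.mul_ne_top (by simp) hmi
    · have h1 : Tendsto (fun n => ballIntegral (w n) r x) atTop (𝓝 0) := by
        simp_rw [ballIntegral_eq_inner]
        exact hweak _
      have h2 := ENNReal.Tendsto.pow (n := 2) h1.enorm
      have h3 := ENNReal.Tendsto.mul_const (b := m x) h2
        (Or.inr ((hm1 x).trans_lt ENNReal.one_lt_top).ne)
      simpa using h3
  rw [ENNReal.tendsto_nhds_zero]
  intro ε hε
  -- The radius is fixed first, making the gradient term small uniformly in `n`; only then does `n`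
  -- tend to infinity.
  obtain ⟨r, hr, hrε⟩ : ∃ r : ℝ, 0 < r ∧ 2 * (ENNReal.ofReal R * ENNReal.ofReal r) ^ 2 < ε / 2 := by
    have hc : Tendsto (fun r : ℝ => 2 * (ENNReal.ofReal R * ENNReal.ofReal r) ^ 2) (𝓝[>] 0)
        (𝓝 (2 * (ENNReal.ofReal R * ENNReal.ofReal 0) ^ 2)) := by
      have hcont : Continuous fun r : ℝ => 2 * (ENNReal.ofReal R * ENNReal.ofReal r) ^ 2 :=
        (ENNReal.continuous_const_mul (by simp)).comp ((ENNReal.continuous_pow 2).comp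
          ((ENNReal.continuous_const_mul ENNReal.ofReal_ne_top).comp ENNReal.continuous_ofReal))
      exact (hcont.tendsto 0).mono_left nhdsWithin_le_nhds
    have h0 : 2 * (ENNReal.ofReal R * ENNReal.ofReal 0) ^ 2 < ε / 2 := by
      simpa using hε.ne'
    obtain ⟨r, hr1, hr2⟩ := ((hc.eventually_lt_const h0).and self_mem_nhdsWithin).exists
    exact ⟨r, hr2, hr1⟩
  have hB0 : volume (Metric.ball (0 : Space N) r) ≠ 0 := (Metric.measure_ball_pos _ _ hr).ne'
  have hlim : Tendsto (fun n => 2 * (volume (Metric.ball (0 : Space N) r) ^ 2)⁻¹ *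
      ∫⁻ x, ‖ballIntegral (w n) r x‖ₑ ^ 2 * m x) atTop (𝓝 0) := by
    have := ENNReal.Tendsto.const_mul (a := 2 * (volume (Metric.ball (0 : Space N) r) ^ 2)⁻¹)
      (hball r) (Or.inr (ENNReal.mul_ne_top (by simp) (by simpa using hB0)))
    simpa using this
  rw [ENNReal.tendsto_nhds_zero] at hlim
  filter_upwards [hlim (ε / 2) (ENNReal.half_pos hε.ne')] with n hn
  calc ∫⁻ x, ‖w n x‖ₑ ^ 2 * m x ≤ _ := lintegral_enorm_sq_mul_le (hw n) hm hm1 hr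
    _ ≤ ε / 2 + 2 * (ENNReal.ofReal R * ENNReal.ofReal r) ^ 2 := by
        gcongr
        rw [← ofReal_norm]
        exact ENNReal.ofReal_le_ofReal (hgR n)
    _ ≤ ε / 2 + ε / 2 := by gcongr
    _ = ε := ENNReal.add_halves ε

end Choquard

/-! ### Weak compactness in `H¹`. -/

namespace Choquard

variable {N : ℕ}

/-- Bounded sequences in a separable Hilbert space have weakly convergent subsequences. -/
theorem exists_subseq_tendsto_inner {E : Type*} [NormedAddCommGroup E] [InnerProductSpace ℝ E]
    [CompleteSpace E] [TopologicalSpace.SeparableSpace E] {x : ℕ → E} {R : ℝ}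
    (hx : ∀ n, ‖x n‖ ≤ R) :
    ∃ (y : E) (k : ℕ → ℕ), StrictMono k ∧
      ∀ z, Tendsto (fun n => inner ℝ z (x (k n))) atTop (𝓝 (inner ℝ z y)) := by
  obtain ⟨φ, -, k, hk, hlim⟩ := WeakDual.isSeqCompact_closedBall ℝ E 0 R
    (x := fun n => StrongDual.toWeakDual (InnerProductSpace.toDual ℝ E (x n)))
    (fun n => by simpa using hx n)
  refine ⟨(InnerProductSpace.toDual ℝ E).symm (WeakDual.toStrongDual φ), k, hk, fun z => ?_⟩
  have h := ((WeakDual.eval_continuous (𝕜 := ℝ) (E := E) z).tendsto φ).comp hlim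
  rw [real_inner_comm, InnerProductSpace.toDual_symm_apply]
  refine h.congr fun n => ?_
  rw [real_inner_comm]
  simp

/-- The Hilbert space `L² × L²` in which `H¹` lives. -/
abbrev L2Pair (N : ℕ) : Type := WithLp 2 (L2 N × L2Field N)

instance (N : ℕ) : TopologicalSpace.SeparableSpace (L2Pair N) := by
  have : Fact ((2 : ℝ≥0∞) ≠ ⊤) := ⟨by simp⟩
  have h1 : SecondCountableTopology (L2 N) := inferInstance
  have h2 : SecondCountableTopology (L2Field N) := inferInstance
  have h3 : TopologicalSpace.SeparableSpace (L2 N × L2Field N) :=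
    @TopologicalSpace.SecondCountableTopology.to_separableSpace _ _ inferInstance
  let e := WithLp.prodContinuousLinearEquiv 2 ℝ (L2 N) (L2Field N)
  exact e.symm.surjective.denseRange.separableSpace e.symm.continuous

theorem inner_field_eq_integral (f g : L2Field N) :
    inner ℝ f g = ∫ x, inner ℝ (f x) (g x) := L2.inner_def f g

theorem inner_eq_integral (f g : L2 N) : inner ℝ f g = ∫ x, f x * g x := by
  rw [L2.inner_def]
  simp [mul_comm]

/-- Each test function and direction defines a vector of `L² × L²`, and `H¹` is the orthogonal
complement of all of them; hence its weak closedness. -/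
theorem exists_inner_eq_weakGradient {φ : Space N → ℝ} (hφ : ContDiff ℝ ∞ φ)
    (hc : HasCompactSupport φ) (v : Space N) : ∃ z : L2Pair N, ∀ w : L2Pair N,
      inner ℝ z w = (∫ x, w.fst x * fderiv ℝ φ x v) + ∫ x, inner ℝ (w.snd x) v * φ x := by
  have h1 : MemLp (fun x => fderiv ℝ φ x v) 2 volume :=
    ((hφ.continuous_fderiv (by simp)).clm_apply continuous_const).memLp_of_hasCompactSupport
      (hc.fderiv_apply ℝ v)
  have h2 : MemLp (fun x => φ x • v) 2 volume :=
    (hφ.continuous.smul continuous_const).memLp_of_hasCompactSupport hc.smul_right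
  refine ⟨WithLp.toLp 2 (h1.toLp, h2.toLp), fun w => ?_⟩
  rw [WithLp.prod_inner_apply, inner_eq_integral, inner_field_eq_integral]
  congr 1
  · refine integral_congr_ae ?_
    filter_upwards [h1.coeFn_toLp] with x hx
    rw [hx, mul_comm]
    rfl
  · refine integral_congr_ae ?_
    filter_upwards [h2.coeFn_toLp] with x hx
    rw [hx, real_inner_smul_left, real_inner_comm, mul_comm]
    rfl

/-- `H¹` is weakly sequentially closed. -/
theorem mem_H1_of_tendsto_inner {u : ℕ → H1 N} {y : L2Pair N}
    (h : ∀ z, Tendsto (fun n => inner ℝ z (u n).1) atTop (𝓝 (inner ℝ z y))) : y ∈ H1 N := by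
  intro φ hφ hc v
  obtain ⟨z, hz⟩ := exists_inner_eq_weakGradient hφ hc v
  have h0 : ∀ n, inner ℝ z (u n).1 = 0 := fun n => by
    rw [hz, (u n).2 φ hφ hc v, neg_add_cancel]
  have hy : inner ℝ z y = 0 :=
    tendsto_nhds_unique (h z) (by simp_rw [h0]; exact tendsto_const_nhds)
  rw [hz] at hy
  linarith

theorem norm_sq_eq (u : H1 N) : ‖u‖ ^ 2 = ‖toL2 u‖ ^ 2 + ‖weakGrad u‖ ^ 2 :=
  WithLp.prod_norm_sq_eq_of_L2 u.1

theorem norm_toL2_le (u : H1 N) : ‖toL2 u‖ ≤ ‖u‖ := by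
  refine (pow_le_pow_iff_left₀ (norm_nonneg _) (norm_nonneg _) two_ne_zero).1 ?_
  rw [norm_sq_eq]
  nlinarith [norm_nonneg (weakGrad u)]

theorem norm_weakGrad_le (u : H1 N) : ‖weakGrad u‖ ≤ ‖u‖ := by
  refine (pow_le_pow_iff_left₀ (norm_nonneg _) (norm_nonneg _) two_ne_zero).1 ?_
  rw [norm_sq_eq]
  nlinarith [norm_nonneg (toL2 u)]

/-- Convergence to zero in a weighted `L²` space gives almost everywhere convergence of a
subsequence. -/
theorem exists_subseq_tendsto_ae {w : ℕ → L2 N} {m : Space N → ℝ≥0∞} (hm : Measurable m)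
    (hm0 : ∀ x, m x ≠ 0) (h : Tendsto (fun n => ∫⁻ x, ‖w n x‖ₑ ^ 2 * m x) atTop (𝓝 0)) :
    ∃ k : ℕ → ℕ, StrictMono k ∧ ∀ᵐ x, Tendsto (fun n => w (k n) x) atTop (𝓝 0) := by
  set μ := (volume : Measure (Space N)).withDensity m
  have hmeas : ∀ n, Measurable (w n) := fun n => (Lp.stronglyMeasurable (w n)).measurable
  have heq : ∀ n, eLpNorm ((w n : Space N → ℝ) - fun _ => 0) 2 μ
      = (∫⁻ x, ‖w n x‖ₑ ^ 2 * m x) ^ (1 / 2 : ℝ) := by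
    intro n
    rw [eLpNorm_eq_lintegral_rpow_enorm_toReal (by simp) (by simp)]
    simp only [ENNReal.toReal_ofNat, ENNReal.rpow_ofNat, Pi.sub_apply, sub_zero]
    rw [lintegral_withDensity_eq_lintegral_mul _ hm ((hmeas n).enorm.pow_const 2)]
    simp [mul_comm]
  have hlim : Tendsto (fun n => eLpNorm ((w n : Space N → ℝ) - fun _ => 0) 2 μ) atTop (𝓝 0) := by
    simp_rw [heq]
    have := ((ENNReal.continuous_rpow_const (y := (1 / 2 : ℝ))).tendsto 0).comp h
    simpa [Function.comp_def] using this
  obtain ⟨k, hk, hae⟩ := (tendstoInMeasure_of_tendsto_eLpNorm (by simp)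
    (fun n => (hmeas n).aestronglyMeasurable) aestronglyMeasurable_const hlim).exists_seq_tendsto_ae
  -- The weight never vanishes, so null sets for the weighted measure are Lebesgue null.
  exact ⟨k, hk, (withDensity_absolutelyContinuous' hm.aemeasurable (.of_forall hm0)).ae_le hae⟩

/-- The compactness properties of bounded sequences in `H¹`. -/
theorem exists_subseq_H1 {u : ℕ → H1 N} {R : ℝ} (hR : ∀ n, ‖u n‖ ≤ R) :
    ∃ (v : H1 N) (k : ℕ → ℕ), StrictMono k ∧
      (∀ z : L2Pair N, Tendsto (fun n => inner ℝ z (u (k n) - v).1) atTop (𝓝 0)) ∧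
      (∀ᵐ x, Tendsto (fun n => toL2 (u (k n)) x) atTop (𝓝 (toL2 v x))) ∧
      ∀ m : Space N → ℝ≥0∞, Measurable m → (∀ x, m x ≤ 1) → ∫⁻ x, m x ≠ ⊤ →
        Tendsto (fun n => ∫⁻ x, ‖toL2 (u (k n) - v) x‖ₑ ^ 2 * m x) atTop (𝓝 0) := by
  obtain ⟨y, k, hk, hy⟩ := exists_subseq_tendsto_inner (x := fun n => (u n).1) (R := R) hR
  set v : H1 N := ⟨y, mem_H1_of_tendsto_inner hy⟩
  have hweak : ∀ z : L2Pair N, Tendsto (fun n => inner ℝ z (u (k n) - v).1) atTop (𝓝 0) := by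
    intro z
    have : Tendsto (fun n => inner ℝ z (u (k n)).1 - inner ℝ z y) atTop (𝓝 0) := by
      simpa using (hy z).sub_const (inner ℝ z y)
    refine this.congr fun n => ?_
    rw [← inner_sub_right]
    rfl
  have hbd : ∀ n, ‖u (k n) - v‖ ≤ R + ‖v‖ := fun n =>
    (norm_sub_le _ _).trans (by gcongr; exact hR _)
  have hrel : ∀ m : Space N → ℝ≥0∞, Measurable m → (∀ x, m x ≤ 1) → ∫⁻ x, m x ≠ ⊤ →
      Tendsto (fun n => ∫⁻ x, ‖toL2 (u (k n) - v) x‖ₑ ^ 2 * m x) atTop (𝓝 0) := by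
    intro m hm hm1 hmi
    refine tendsto_lintegral_enorm_sq_mul (g := fun n => weakGrad (u (k n) - v))
      (fun n => (u (k n) - v).2) (fun n => (norm_toL2_le _).trans (hbd n))
      (fun n => (norm_weakGrad_le _).trans (hbd n)) (fun ψ => ?_) hm hm1 hmi
    refine (hweak (WithLp.toLp 2 (ψ, 0))).congr fun n => ?_
    rw [WithLp.prod_inner_apply]
    simp
  -- A Gaussian weight is positive and integrable, so one extraction gives convergence almost
  -- everywhere on the whole space, with no diagonal argument over balls.
  have hgm : Measurable fun x : Space N => gaussianBump ((1 : ℝ), (0 : Space N)) x :=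
    measurable_gaussianBump.comp measurable_prodMk_left
  obtain ⟨l, hl, hae⟩ := exists_subseq_tendsto_ae hgm
    (fun x => by simp [gaussianBump, Real.exp_pos])
    (hrel _ hgm (gaussianBump_le_one (by simp)) (lintegral_gaussianBump_ne_top (by simp)))
  refine ⟨v, k ∘ l, hk.comp hl, fun z => (hweak z).comp hl.tendsto_atTop, ?_,
    fun m hm hm1 hmi => (hrel m hm hm1 hmi).comp hl.tendsto_atTop⟩
  have hsub : ∀ᵐ x, ∀ n, toL2 (u (k (l n)) - v) x = toL2 (u (k (l n))) x - toL2 v x := by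
    rw [ae_all_iff]
    intro n
    exact Lp.coeFn_sub (toL2 (u (k (l n)))) (toL2 v)
  filter_upwards [hae, hsub] with x hx hx2
  simp_rw [hx2] at hx
  simpa using hx.add_const (toL2 v x)

/-! ### The quadratic energy and its lower bound up to local mass. -/

section Energy

variable {V : Space N → ℝ}

theorem memLp_mul_of_memLp_top (hV : MemLp V ⊤ volume) (u : L2 N) :
    MemLp (fun x => V x * u x) 2 volume :=
  MemLp.mul (p := ⊤) (q := 2) (r := 2) (Lp.memLp u) hV

theorem integrable_potential_mul (hV : MemLp V ⊤ volume) (u w : L2 N) :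
    Integrable fun x => V x * u x * w x :=
  (memLp_mul_of_memLp_top hV u).integrable_mul (Lp.memLp w)

theorem energy_eq (hV : MemLp V ⊤ volume) (u : H1 N) :
    energy V u = ‖weakGrad u‖ ^ 2 + ∫ x, V x * toL2 u x * toL2 u x := by
  have h1 : ∀ x, ‖weakGrad u x‖ ^ 2 + V x * |toL2 u x| ^ 2
      = inner ℝ (weakGrad u x) (weakGrad u x) + V x * toL2 u x * toL2 u x := by
    intro x
    rw [real_inner_self_eq_norm_sq, sq_abs]
    ring
  rw [energy, ← real_inner_self_eq_norm_sq, inner_field_eq_integral]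
  simp_rw [h1]
  exact integral_add (L2.integrable_inner _ _) (integrable_potential_mul hV _ _)

/-- The energy is a quadratic form whose polarization is weakly continuous. -/
theorem exists_energy_add_eq (hV : MemLp V ⊤ volume) (u : H1 N) : ∃ z : L2Pair N, ∀ w : H1 N,
    energy V (u + w) = energy V u + 2 * inner ℝ z w.1 + energy V w := by
  have hm := memLp_mul_of_memLp_top hV (toL2 u)
  refine ⟨WithLp.toLp 2 (hm.toLp, weakGrad u), fun w => ?_⟩
  have hin : inner ℝ (WithLp.toLp 2 (hm.toLp, weakGrad u)) w.1
      = (∫ x, V x * toL2 u x * toL2 w x) + inner ℝ (weakGrad u) (weakGrad w) := by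
    rw [WithLp.prod_inner_apply, inner_eq_integral]
    congr 1
    refine integral_congr_ae ?_
    filter_upwards [hm.coeFn_toLp] with x hx
    rw [hx]
    rfl
  have hV2 : ∫ x, V x * toL2 (u + w) x * toL2 (u + w) x = (∫ x, V x * toL2 u x * toL2 u x)
      + 2 * (∫ x, V x * toL2 u x * toL2 w x) + ∫ x, V x * toL2 w x * toL2 w x := by
    have i1 := integrable_potential_mul hV (toL2 u) (toL2 u)
    have i2 := (integrable_potential_mul hV (toL2 u) (toL2 w)).const_mul 2
    have i3 := integrable_potential_mul hV (toL2 w) (toL2 w)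
    have i12 : Integrable fun x => V x * toL2 u x * toL2 u x + 2 * (V x * toL2 u x * toL2 w x) :=
      i1.add i2
    rw [← integral_const_mul, ← integral_add i1 i2, ← integral_add i12 i3]
    refine integral_congr_ae ?_
    filter_upwards [Lp.coeFn_add (toL2 u) (toL2 w)] with x hx
    change V x * (toL2 u + toL2 w : L2 N) x * (toL2 u + toL2 w : L2 N) x = _
    rw [hx, Pi.add_apply]
    ring
  have hg : ‖weakGrad (u + w)‖ ^ 2 = ‖weakGrad u‖ ^ 2 + 2 * inner ℝ (weakGrad u) (weakGrad w)
      + ‖weakGrad w‖ ^ 2 := norm_add_sq_real _ _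
  rw [energy_eq hV, energy_eq hV, energy_eq hV, hin, hV2, hg]
  ring

theorem energy_smul (c : ℝ) (u : H1 N) : energy V (c • u) = c ^ 2 * energy V u := by
  rw [energy, energy, ← integral_const_mul]
  refine integral_congr_ae ?_
  filter_upwards [Lp.coeFn_smul c (toL2 u), Lp.coeFn_smul c (weakGrad u)] with x h1 h2
  change ‖(c • weakGrad u : L2Field N) x‖ ^ 2 + V x * |(c • toL2 u : L2 N) x| ^ 2 = _
  rw [h1, h2, Pi.smul_apply, Pi.smul_apply, norm_smul, smul_eq_mul, abs_mul, mul_pow, mul_pow,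
    Real.norm_eq_abs, sq_abs]
  ring

theorem exists_potential_lower_bound (hV : MemLp V ⊤ volume) (hVl : 1 ≤ liminfAtInfinity V)
    {a : ℝ} (ha : a < 1) : ∃ r K : ℝ, 0 ≤ K ∧
      ∀ᵐ x, a - K * (Metric.closedBall (0 : Space N) r).indicator 1 x ≤ V x := by
  have h1 : (a : EReal) < liminfAtInfinity V := lt_of_lt_of_le (by exact_mod_cast ha) hVl
  have h2 := eventually_lt_of_lt_liminf h1
  obtain ⟨s, hs, t, ht, hst⟩ := Filter.mem_inf_iff_superset.1 h2
  obtain ⟨S, hS, hSs⟩ := Filter.hasBasis_cocompact.mem_iff.1 hs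
  obtain ⟨r, hr⟩ := hS.isBounded.subset_closedBall (0 : Space N)
  have hfin : eLpNormEssSup V volume ≠ ⊤ := by simpa using hV.2.ne
  have hM : ∀ᵐ x, |V x| ≤ (eLpNormEssSup V volume).toReal := by
    filter_upwards [ae_le_eLpNormEssSup (f := V) (μ := volume)] with x hx
    rw [← Real.norm_eq_abs, ← toReal_enorm]
    exact ENNReal.toReal_mono hfin hx
  -- This `K` makes `a - K ≤ -‖V‖_∞` on the ball; outside it `V` exceeds `a`.
  refine ⟨r, |a| + (eLpNormEssSup V volume).toReal, by positivity, ?_⟩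
  filter_upwards [hM, ht] with x hx hxt
  by_cases hxr : x ∈ Metric.closedBall (0 : Space N) r
  · rw [Set.indicator_of_mem hxr, Pi.one_apply]
    linarith [le_abs_self a, neg_abs_le (V x)]
  · rw [Set.indicator_of_notMem hxr]
    have hxs : x ∈ s := hSs fun h => hxr (hr h)
    have hlt : (a : EReal) < V x := hst ⟨hxs, hxt⟩
    have := EReal.coe_lt_coe_iff.1 hlt
    linarith

/-- The negative part of the potential costs only the `L²` mass on a fixed ball, which Rellich sends
to `0` for the remainders. -/
theorem energy_lower_bound (hV : MemLp V ⊤ volume) {a r K : ℝ}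
    (hb : ∀ᵐ x, a - K * (Metric.closedBall (0 : Space N) r).indicator 1 x ≤ V x) (u : H1 N) :
    ‖weakGrad u‖ ^ 2 + a * ‖toL2 u‖ ^ 2 - K * (∫⁻ x, ‖toL2 u x‖ₑ ^ 2 *
      (Metric.closedBall (0 : Space N) r).indicator 1 x).toReal ≤ energy V u := by
  set B := Metric.closedBall (0 : Space N) r
  have hBm : MeasurableSet B := Metric.isClosed_closedBall.measurableSet
  have i1 : Integrable fun x => toL2 u x * toL2 u x := (Lp.memLp (toL2 u)).integrable_mul
    (Lp.memLp (toL2 u))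
  have i2 : Integrable (B.indicator fun x => toL2 u x * toL2 u x) := i1.indicator hBm
  have hB : (∫⁻ x, ‖toL2 u x‖ₑ ^ 2 * B.indicator 1 x).toReal
      = ∫ x, B.indicator (fun x => toL2 u x * toL2 u x) x := by
    rw [integral_eq_lintegral_of_nonneg_ae (.of_forall fun x =>
      Set.indicator_nonneg (fun x _ => mul_self_nonneg _) x) i2.aestronglyMeasurable]
    congr 1
    refine lintegral_congr fun x => ?_
    by_cases hx : x ∈ B
    · rw [Set.indicator_of_mem hx, Set.indicator_of_mem hx, Pi.one_apply, mul_one,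
        Real.enorm_eq_ofReal_abs, ← ENNReal.ofReal_pow (abs_nonneg _), sq_abs, sq]
    · simp [Set.indicator_of_notMem hx]
  have hle : a * (∫ x, toL2 u x * toL2 u x)
      - K * ∫ x, B.indicator (fun x => toL2 u x * toL2 u x) x
      ≤ ∫ x, V x * toL2 u x * toL2 u x := by
    rw [← integral_const_mul, ← integral_const_mul,
      ← integral_sub (i1.const_mul a) (i2.const_mul K)]
    refine integral_mono_ae ((i1.const_mul a).sub (i2.const_mul K))
      (integrable_potential_mul hV _ _) ?_
    filter_upwards [hb] with x hx
    have h0 := mul_self_nonneg (toL2 u x)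
    have h1 := mul_le_mul_of_nonneg_right hx h0
    by_cases hxB : x ∈ B
    · simp only [Set.indicator_of_mem hxB, Pi.one_apply] at h1 ⊢
      linarith
    · simp only [Set.indicator_of_notMem hxB] at h1 ⊢
      linarith
  have hn : ‖toL2 u‖ ^ 2 = ∫ x, toL2 u x * toL2 u x := by
    rw [← real_inner_self_eq_norm_sq, inner_eq_integral]
  rw [energy_eq hV, hB, hn]
  linarith

end Energy

end Choquard

/-! ### The variational argument. -/

namespace Choquard

variable {N : ℕ} {α : ℝ} {V : Space N → ℝ}

theorem measurable_indicator_closedBall (r : ℝ) : Measurable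
    ((Metric.closedBall (0 : Space N) r).indicator (1 : Space N → ℝ≥0∞)) :=
  measurable_one.indicator Metric.isClosed_closedBall.measurableSet

theorem indicator_closedBall_le_one (r : ℝ) (x : Space N) :
    (Metric.closedBall (0 : Space N) r).indicator (1 : Space N → ℝ≥0∞) x ≤ 1 :=
  Set.indicator_le_self' (fun _ _ => zero_le) x

theorem lintegral_indicator_closedBall_ne_top (r : ℝ) :
    ∫⁻ x, (Metric.closedBall (0 : Space N) r).indicator (1 : Space N → ℝ≥0∞) x ≠ ⊤ := by
  rw [lintegral_indicator_one Metric.isClosed_closedBall.measurableSet]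
  exact measure_closedBall_lt_top.ne

/-- Normalization of the nonlocal energy by scaling. -/
theorem exists_smul_nonlocalEnergy_eq_one (h0 : 0 < α) (hN : α < N) {u : L2 N}
    (hu0 : nonlocalEnergy α u ≠ 0) (hut : nonlocalEnergy α u ≠ ⊤) :
    ∃ c : ℝ, nonlocalEnergy α (c • u) = 1 ∧
      c ^ 2 * (nonlocalEnergy α u).toReal ^ (1 / (α / N + 1)) = 1 := by
  have hp := one_lt_exponent h0 hN
  set p := α / N + 1
  set d := (nonlocalEnergy α u).toReal
  have hd : 0 < d := ENNReal.toReal_pos hu0 hut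
  -- The exponent reflects that the nonlocal energy is homogeneous of degree `2p`.
  have hc : 0 < d ^ (-(1 / (2 * p))) := by positivity
  refine ⟨d ^ (-(1 / (2 * p))), ?_, ?_⟩
  · rw [nonlocalEnergy_smul h0 hN, Real.enorm_of_nonneg hc.le,
      ENNReal.ofReal_rpow_of_pos hc, ← ENNReal.ofReal_pow (by positivity),
      ← ENNReal.ofReal_toReal hut, ← ENNReal.ofReal_mul (by positivity)]
    change ENNReal.ofReal (((d ^ (-(1 / (2 * p)))) ^ p) ^ 2 * d) = 1
    rw [← Real.rpow_natCast, ← Real.rpow_mul hd.le, ← Real.rpow_mul hd.le]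
    have : -(1 / (2 * p)) * p * ((2 : ℕ) : ℝ) = -1 := by
      push_cast
      field_simp
    rw [this, Real.rpow_neg_one, inv_mul_cancel₀ hd.ne', ENNReal.ofReal_one]
  · rw [← Real.rpow_natCast, ← Real.rpow_mul hd.le, ← Real.rpow_add hd]
    have : -(1 / (2 * p)) * ((2 : ℕ) : ℝ) + 1 / p = 0 := by
      push_cast
      field_simp
      ring
    rw [this, Real.rpow_zero]

theorem mul_rpow_le_norm_sq (h0 : 0 < α) (hN : α < N) {γ : ℝ} (hγ : (γ : EReal) ≤ cInfty N α)
    {u : L2 N} (hut : nonlocalEnergy α u ≠ ⊤) :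
    γ * (nonlocalEnergy α u).toReal ^ (1 / (α / N + 1)) ≤ ‖u‖ ^ 2 := by
  have hp := one_lt_exponent h0 hN
  by_cases hu0 : nonlocalEnergy α u = 0
  · rw [hu0, ENNReal.toReal_zero, Real.zero_rpow (by positivity), mul_zero]
    positivity
  · obtain ⟨c, hc1, hc2⟩ := exists_smul_nonlocalEnergy_eq_one h0 hN hu0 hut
    have h1 : (γ : EReal) ≤ ((∫ x, |(c • u : L2 N) x| ^ 2 : ℝ) : EReal) :=
      hγ.trans (sInf_le ⟨c • u, hc1, rfl⟩)
    rw [EReal.coe_le_coe_iff, integral_abs_sq_eq, norm_smul, mul_pow, Real.norm_eq_abs,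
      sq_abs] at h1
    have hd : 0 ≤ (nonlocalEnergy α u).toReal ^ (1 / (α / N + 1)) := by positivity
    calc _ ≤ c ^ 2 * ‖u‖ ^ 2 * (nonlocalEnergy α u).toReal ^ (1 / (α / N + 1)) := by gcongr
      _ = (c ^ 2 * (nonlocalEnergy α u).toReal ^ (1 / (α / N + 1))) * ‖u‖ ^ 2 := by ring
      _ = _ := by rw [hc2, one_mul]

/-- Scale to nonlocal energy `1`; energies are homogeneous of degree `2`. When the nonlocal energy
vanishes the function must be shown to be zero, since `V` may be negative and the sign of the energy
is otherwise unknown. -/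
theorem mul_rpow_le_energy (h0 : 0 < α) (hN : α < N) (hV : MemLp V ⊤ volume) {c : ℝ}
    (hc : (c : EReal) ≤ cStar α V) {u : H1 N} (hut : nonlocalEnergy α (toL2 u) ≠ ⊤) :
    c * (nonlocalEnergy α (toL2 u)).toReal ^ (1 / (α / N + 1)) ≤ energy V u := by
  have hp := one_lt_exponent h0 hN
  by_cases hu0 : nonlocalEnergy α (toL2 u) = 0
  · have hzero : ∫ x, V x * toL2 u x * toL2 u x = 0 := by
      refine integral_eq_zero_of_ae ?_
      rw [eq_zero_of_nonlocalEnergy_eq_zero h0 hN hu0]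
      exact .of_forall fun x => by simp
    rw [hu0, ENNReal.toReal_zero, Real.zero_rpow (by positivity), mul_zero, energy_eq hV, hzero]
    positivity
  · obtain ⟨t, ht1, ht2⟩ := exists_smul_nonlocalEnergy_eq_one h0 hN hu0 hut
    have h1 : (c : EReal) ≤ (energy V (t • u) : EReal) := hc.trans (sInf_le ⟨t • u, ht1, rfl⟩)
    rw [EReal.coe_le_coe_iff, energy_smul] at h1
    calc _ ≤ t ^ 2 * energy V u * (nonlocalEnergy α (toL2 u)).toReal ^ (1 / (α / N + 1)) := by
          gcongr
      _ = (t ^ 2 * (nonlocalEnergy α (toL2 u)).toReal ^ (1 / (α / N + 1))) * energy V u := by ring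
      _ = _ := by rw [ht2, one_mul]

/-- Normalized sequences with energy bounded from above are bounded in `H¹`. -/
theorem exists_norm_le_of_energy_le (h0 : 0 < α) (hN : α < N) (hV : MemLp V ⊤ volume)
    (hVl : 1 ≤ liminfAtInfinity V) {u : ℕ → H1 N} {C : ℝ}
    (hD : ∀ n, nonlocalEnergy α (toL2 (u n)) = 1) (hE : ∀ n, energy V (u n) ≤ C) :
    ∃ R, ∀ n, ‖u n‖ ≤ R := by
  have hp := one_lt_exponent h0 hN
  -- Otherwise normalize a subsequence with norms tending to infinity. Its nonlocal energy tends to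
  -- `0`, so its weak limit is `0` and its local mass vanishes; the lower bound with `a = 1/2` then
  -- contradicts norm `1`.
  by_contra! hcon
  choose j hj using fun n : ℕ => hcon (n + 1)
  set t : ℕ → ℝ := fun n => ‖u (j n)‖
  have ht0 : ∀ n, 0 < t n := fun n => (by positivity : (0 : ℝ) < n + 1).trans (hj n)
  have htinv : Tendsto (fun n => (t n)⁻¹) atTop (𝓝 0) := by
    refine tendsto_inv_atTop_zero.comp (tendsto_atTop_mono (fun n => (hj n).le) ?_)
    exact tendsto_atTop_add_const_right _ _ tendsto_natCast_atTop_atTop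
  set v : ℕ → H1 N := fun n => (t n)⁻¹ • u (j n)
  have hv1 : ∀ n, ‖v n‖ = 1 := fun n => by
    rw [norm_smul, norm_inv, Real.norm_eq_abs, abs_of_pos (ht0 n)]
    exact inv_mul_cancel₀ (ht0 n).ne'
  obtain ⟨w, k, hk, -, hae, hrel⟩ := exists_subseq_H1 (u := v) (R := 1) fun n => (hv1 n).le
  have hDv : Tendsto (fun n => nonlocalEnergy α (toL2 (v (k n)))) atTop (𝓝 0) := by
    have h1 : ∀ n, nonlocalEnergy α (toL2 (v n)) = (‖(t n)⁻¹‖ₑ ^ (α / N + 1)) ^ 2 := fun n =>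
      (nonlocalEnergy_smul h0 hN _ (toL2 (u (j n)))).trans (by rw [hD, mul_one])
    simp_rw [h1]
    have h2 := ((ENNReal.continuous_pow 2).tendsto _).comp
      (((ENNReal.continuous_rpow_const (y := α / N + 1)).tendsto _).comp
        (htinv.comp hk.tendsto_atTop).enorm)
    simpa [Function.comp_def, ENNReal.zero_rpow_of_pos (by linarith : 0 < α / N + 1)] using h2
  have hw : toL2 w = 0 := by
    refine eq_zero_of_nonlocalEnergy_eq_zero h0 hN (le_antisymm ?_ zero_le)
    exact (nonlocalEnergy_le_liminf h0 hN hae).trans hDv.liminf_eq.le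
  obtain ⟨r, K, hK, hb⟩ := exists_potential_lower_bound hV hVl (a := 1 / 2) (by norm_num)
  have hη := (ENNReal.tendsto_toReal ENNReal.zero_ne_top).comp (hrel _
    (measurable_indicator_closedBall r) (indicator_closedBall_le_one r)
    (lintegral_indicator_closedBall_ne_top r))
  have hsub : ∀ n, toL2 (v (k n) - w) = toL2 (v (k n)) := fun n => by
    change toL2 (v (k n)) - toL2 w = _
    rw [hw, sub_zero]
  simp only [Function.comp_def, hsub, ENNReal.toReal_zero] at hη
  have hlow : ∀ n, 1 / 2 ≤ ((t (k n))⁻¹) ^ 2 * C + K * (∫⁻ x, ‖toL2 (v (k n)) x‖ₑ ^ 2 *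
      (Metric.closedBall (0 : Space N) r).indicator 1 x).toReal := by
    intro n
    have h1 := energy_lower_bound hV hb (v (k n))
    have h2 : energy V (v (k n)) ≤ ((t (k n))⁻¹) ^ 2 * C := by
      rw [energy_smul]
      gcongr
      exact hE _
    have h3 := norm_sq_eq (v (k n))
    rw [hv1] at h3
    nlinarith [sq_nonneg ‖weakGrad (v (k n))‖]
  have hlim := (((htinv.comp hk.tendsto_atTop).pow 2).mul_const C).add (hη.const_mul K)
  have := ge_of_tendsto' hlim hlow
  norm_num at this

/-- Minimizing sequences subconverge strongly to minimizers. -/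
theorem exists_subseq_tendsto_minimizer (h0 : 0 < α) (hN : α < N) (hV : MemLp V ⊤ volume)
    (hVl : 1 ≤ liminfAtInfinity V) (hc : cStar α V < cInfty N α) {u : ℕ → H1 N}
    (hu : IsMinimizingSeq α V u) :
    ∃ (k : ℕ → ℕ) (w : H1 N), StrictMono k ∧ Tendsto (fun n => u (k n)) atTop (𝓝 w) ∧
      IsMinimizer α V w := by
  have hp := one_lt_exponent h0 hN
  obtain ⟨hD, hE⟩ := hu
  -- a bounded subsequence
  obtain ⟨C, hC1, -⟩ := EReal.lt_iff_exists_real_btwn.1 (hc.trans_le le_top)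
  obtain ⟨n₀, hn₀⟩ := eventually_atTop.1 (hE.eventually_lt_const hC1)
  obtain ⟨R, hR⟩ := exists_norm_le_of_energy_le h0 hN hV hVl (u := fun n => u (n + n₀)) (C := C)
    (fun n => hD _) fun n => (EReal.coe_lt_coe_iff.1 (hn₀ (n + n₀) (by omega))).le
  obtain ⟨v, l, hl, hweak, hae, hrel⟩ := exists_subseq_H1 hR
  set k : ℕ → ℕ := fun n => l n + n₀
  have hk : StrictMono k := fun a b hab => Nat.add_lt_add_right (hl hab) n₀
  set w : ℕ → H1 N := fun n => u (k n) - v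
  have hEk : Tendsto (fun n => (energy V (u (k n)) : EReal)) atTop (𝓝 (cStar α V)) :=
    hE.comp hk.tendsto_atTop
  obtain ⟨z, hz⟩ := exists_energy_add_eq hV v
  have hsplit : ∀ n, energy V (u (k n)) = energy V v + 2 * inner ℝ z (w n).1 + energy V (w n) := by
    intro n
    rw [← hz, add_sub_cancel]
  -- lower bounds for the energy of the remainder
  have hη : ∀ r, Tendsto (fun n => (∫⁻ x, ‖toL2 (w n) x‖ₑ ^ 2 *
      (Metric.closedBall (0 : Space N) r).indicator 1 x).toReal) atTop (𝓝 0) := fun r =>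
    (ENNReal.tendsto_toReal ENNReal.zero_ne_top).comp (hrel _
      (measurable_indicator_closedBall r) (indicator_closedBall_le_one r)
      (lintegral_indicator_closedBall_ne_top r))
  have hlow : ∀ a < 1, ∃ e : ℕ → ℝ, Tendsto e atTop (𝓝 0) ∧
      ∀ n, ‖weakGrad (w n)‖ ^ 2 + a * ‖toL2 (w n)‖ ^ 2 ≤ energy V (w n) + e n := by
    intro a ha
    obtain ⟨r, K, -, hb⟩ := exists_potential_lower_bound hV hVl ha
    refine ⟨fun n => K * (∫⁻ x, ‖toL2 (w n) x‖ₑ ^ 2 *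
      (Metric.closedBall (0 : Space N) r).indicator 1 x).toReal, ?_, fun n => ?_⟩
    · simpa using (hη r).const_mul K
    · linarith [energy_lower_bound hV hb (w n)]
  obtain ⟨e, he, hle⟩ := hlow (1 / 2) (by norm_num)
  -- Weak lower semicontinuity of the energy; it also excludes `c_* = -∞`.
  have hEv : (energy V v : EReal) ≤ cStar α V := by
    have h1 : Tendsto (fun n => energy V v + 2 * inner ℝ z (w n).1 - e n) atTop
        (𝓝 (energy V v)) := by
      have h2 := (((hweak z).const_mul 2).const_add (energy V v)).sub he
      rwa [mul_zero, add_zero, sub_zero] at h2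
    refine le_of_tendsto_of_tendsto' (EReal.tendsto_coe.2 h1) hEk fun n => ?_
    rw [EReal.coe_le_coe_iff, hsplit]
    linarith [hle n, sq_nonneg ‖weakGrad (w n)‖, sq_nonneg ‖toL2 (w n)‖]
  -- the levels are real numbers
  obtain ⟨c, hcc⟩ : ∃ c : ℝ, (c : EReal) = cStar α V :=
    ⟨_, EReal.coe_toReal (hc.trans_le le_top).ne (bot_lt_iff_ne_bot.1
      ((EReal.bot_lt_coe _).trans_le hEv))⟩
  have hγtop : cInfty N α ≠ ⊤ := by
    have : cInfty N α ≤ ((∫ x, |toL2 (u 0) x| ^ 2 : ℝ) : EReal) := sInf_le ⟨_, hD 0, rfl⟩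
    exact (this.trans_lt (EReal.coe_lt_top _)).ne
  have hγ0 : 0 ≤ cInfty N α := by
    refine le_sInf ?_
    rintro _ ⟨f, -, rfl⟩
    exact EReal.coe_nonneg.2 (integral_nonneg fun x => by positivity)
  obtain ⟨γ, hγ⟩ : ∃ γ : ℝ, (γ : EReal) = cInfty N α :=
    ⟨_, EReal.coe_toReal hγtop (bot_lt_iff_ne_bot.1 (EReal.bot_lt_zero.trans_le hγ0))⟩
  rw [← hγ] at hγ0
  rw [← hcc, ← hγ, EReal.coe_lt_coe_iff] at hc
  rw [← hcc] at hEk hEv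
  have hγ0' : 0 ≤ γ := EReal.coe_nonneg.1 hγ0
  have hEv' : energy V v ≤ c := EReal.coe_le_coe_iff.1 hEv
  have hEw : Tendsto (fun n => energy V (w n)) atTop (𝓝 (c - energy V v)) := by
    have h1 := ((EReal.tendsto_coe.1 hEk).sub ((hweak z).const_mul 2)).sub_const (energy V v)
    rw [mul_zero, sub_zero] at h1
    refine h1.congr fun n => ?_
    rw [hsplit]
    ring
  -- no loss of nonlocal energy
  have hDle : nonlocalEnergy α (toL2 v) ≤ 1 := by
    refine (nonlocalEnergy_le_liminf h0 hN hae).trans ?_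
    simp only [hD]
    simp
  have hDt : nonlocalEnergy α (toL2 v) ≠ ⊤ := (hDle.trans_lt ENNReal.one_lt_top).ne
  set d := (nonlocalEnergy α (toL2 v)).toReal with hd
  set θ := 1 / (α / N + 1) with hθ
  have hθ0 : 0 < θ := by positivity
  have hθ1 : θ ≤ 1 := by rw [hθ, div_le_one (by linarith)]; exact hp.le
  have hd0 : 0 ≤ d := ENNReal.toReal_nonneg
  have hd1 : d ≤ 1 := by
    simpa using ENNReal.toReal_mono ENNReal.one_ne_top hDle
  have hcv : c * d ^ θ ≤ energy V v := mul_rpow_le_energy h0 hN hV hcc.le hDt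
  have hDw : ∀ n, nonlocalEnergy α (toL2 (w n)) ≠ ⊤ := by
    intro n
    refine ((nonlocalEnergy_sub_le h0 hN (toL2 (u (k n))) (toL2 v)).trans_lt ?_).ne
    rw [hD]
    exact ENNReal.mul_lt_top (ENNReal.mul_lt_top (by simp)
      (ENNReal.pow_lt_top (ENNReal.rpow_lt_top_of_nonneg (by linarith) (by simp))))
      (ENNReal.add_lt_top.2 ⟨ENNReal.one_lt_top, hDt.lt_top⟩)
  have hd_eq : d = 1 := by
    by_contra hne
    have hdlt : d < 1 := lt_of_le_of_ne hd1 hne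
    -- The same `t < 1` serves twice: as the lower bound for `V` at infinity and as the fraction of
    -- the missing nonlocal energy `1 - d` carried by the remainders.
    have hkey : ∀ t ∈ Set.Ioo (0 : ℝ) 1, t * (γ * (t * (1 - d)) ^ θ) ≤ c - energy V v := by
      intro t ht
      obtain ⟨e', he', hle'⟩ := hlow t ht.2
      have hs : 0 ≤ t * (1 - d) := mul_nonneg ht.1.le (by linarith)
      have hev : ∀ᶠ n in atTop, ENNReal.ofReal (t * (1 - d)) < nonlocalEnergy α (toL2 (w n)) := by
        -- If the remainders had at most `t (1-d)` infinitely often, the splitting inequality would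
        -- give `1 ≤ d + t (1-d) < 1`.
        by_contra hfreq
        rw [Filter.not_eventually] at hfreq
        have h1 := one_le_nonlocalEnergy_add h0 hN (u := toL2 v) (v := fun n => toL2 (u (k n)))
          (R := R + ‖v‖) (fun n => (norm_toL2_le (w n)).trans ((norm_sub_le _ _).trans
            (by gcongr; exact hR _))) (fun n => hD _) hae
          (hfreq.mono fun n hn => not_lt.1 hn)
        rw [← ENNReal.ofReal_toReal hDt, ← ENNReal.ofReal_add hd0 hs, ENNReal.one_le_ofReal] at h1
        nlinarith [ht.2]
      have hlim := hEw.add he'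
      rw [add_zero] at hlim
      refine ge_of_tendsto hlim (hev.mono fun n hn => ?_)
      have h1 := mul_rpow_le_norm_sq h0 hN hγ.le (hDw n)
      have h2 : t * (1 - d) ≤ (nonlocalEnergy α (toL2 (w n))).toReal :=
        (ENNReal.ofReal_le_iff_le_toReal (hDw n)).1 hn.le
      have h3 : γ * (t * (1 - d)) ^ θ ≤ ‖toL2 (w n)‖ ^ 2 :=
        le_trans (by gcongr) h1
      have h4 := mul_le_mul_of_nonneg_left h3 ht.1.le
      linarith [hle' n, sq_nonneg ‖weakGrad (w n)‖]
    have hlim : Tendsto (fun t : ℝ => t * (γ * (t * (1 - d)) ^ θ)) (𝓝[<] 1)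
        (𝓝 (1 * (γ * (1 * (1 - d)) ^ θ))) := by
      have hcont : Continuous fun t : ℝ => t * (γ * (t * (1 - d)) ^ θ) :=
        continuous_id.mul (continuous_const.mul
          ((continuous_id.mul continuous_const).rpow_const fun _ => Or.inr hθ0.le))
      exact (hcont.tendsto 1).mono_left nhdsWithin_le_nhds
    have hfin : 1 * (γ * (1 * (1 - d)) ^ θ) ≤ c - energy V v :=
      le_of_tendsto hlim (by
        filter_upwards [Ioo_mem_nhdsLT (zero_lt_one (α := ℝ))] with t ht using hkey t ht)
    rw [one_mul, one_mul] at hfin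
    -- Since `θ ≤ 1`, `d^θ + (1-d)^θ ≥ 1`; hence `c (1 - d^θ) ≥ γ (1-d)^θ ≥ γ (1 - d^θ)`,
    -- contradicting `c < γ`.
    have h1 : d ^ θ < 1 := Real.rpow_lt_one hd0 hdlt hθ0
    have h2 : d ≤ d ^ θ := Real.self_le_rpow_of_le_one hd0 hd1 hθ1
    have h3 : 1 - d ≤ (1 - d) ^ θ :=
      Real.self_le_rpow_of_le_one (by linarith) (by linarith) hθ1
    have h4 : γ * (1 - d ^ θ) ≤ γ * (1 - d) ^ θ := by gcongr; linarith
    have h5 : c * (1 - d ^ θ) < γ * (1 - d ^ θ) := by gcongr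
    linarith
  have hDv : nonlocalEnergy α (toL2 v) = 1 := by
    rw [← ENNReal.ofReal_toReal hDt, ← hd, hd_eq, ENNReal.ofReal_one]
  have hEeq : energy V v = c := by
    refine le_antisymm hEv' ?_
    have : cStar α V ≤ (energy V v : EReal) := sInf_le ⟨v, hDv, rfl⟩
    rwa [← hcc, EReal.coe_le_coe_iff] at this
  refine ⟨k, v, hk, ?_, hDv, by rw [hEeq, hcc]⟩
  -- strong convergence
  have hw2 : Tendsto (fun n => ‖w n‖ ^ 2) atTop (𝓝 0) := by
    have h1 := (hEw.add he).const_mul 2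
    rw [hEeq, sub_self, add_zero, mul_zero] at h1
    refine squeeze_zero (fun n => sq_nonneg _) (fun n => ?_) h1
    rw [norm_sq_eq]
    linarith [hle n, sq_nonneg ‖weakGrad (w n)‖]
  rw [tendsto_iff_norm_sub_tendsto_zero]
  have h2 := hw2.sqrt
  simpa [Real.sqrt_sq (norm_nonneg _), w] using h2

/-- Finiteness from above provides a competitor, the infimum of the empty set being `⊤`. -/
theorem exists_isMinimizingSeq (h : cStar α V < ⊤) : ∃ u : ℕ → H1 N, IsMinimizingSeq α V u := by
  have hne : {c : EReal | ∃ u : H1 N, nonlocalEnergy α (toL2 u) = 1 ∧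
      c = (energy V u : EReal)}.Nonempty := by
    by_contra hempty
    rw [Set.not_nonempty_iff_eq_empty] at hempty
    rw [cStar, hempty, sInf_empty] at h
    exact lt_irrefl _ h
  obtain ⟨c, -, hc, hmem⟩ := exists_seq_tendsto_sInf hne (OrderBot.bddBelow _)
  choose u hu1 hu2 using hmem
  exact ⟨u, hu1, hc.congr hu2⟩

end Choquard

theorem mainTheorem1 (N : ℕ) (α : ℝ) (hα_pos : 0 < α) (hα_lt : α < N)
    (V : Choquard.Space N → ℝ) (hV : MemLp V ∞ volume)
    (hV_liminf : 1 ≤ Choquard.liminfAtInfinity V)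
    (hc : Choquard.cStar α V < Choquard.cInfty N α) :
    (∃ u : Choquard.H1 N, Choquard.IsMinimizer α V u) ∧
      ∀ u : ℕ → Choquard.H1 N, Choquard.IsMinimizingSeq α V u →
        ∃ (k : ℕ → ℕ) (w : Choquard.H1 N), StrictMono k ∧
          Tendsto (fun n => u (k n)) atTop (𝓝 w) := by
  constructor
  · obtain ⟨u, hu⟩ := Choquard.exists_isMinimizingSeq (hc.trans_le le_top)
    obtain ⟨_, w, -, -, hw⟩ :=
      Choquard.exists_subseq_tendsto_minimizer hα_pos hα_lt hV hV_liminf hc hu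
    exact ⟨w, hw⟩
  · intro u hu
    obtain ⟨k, w, hk, hlim, -⟩ :=
      Choquard.exists_subseq_tendsto_minimizer hα_pos hα_lt hV hV_liminf hc hu
    exact ⟨k, w, hk, hlim⟩
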